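/- Let $\psi_b:\mathbb{R}\to\mathbb{R}$ be twice differentiable with $|\psi_b|_\infty+|\psi_b'|_\infty+|\psi_b''|_\infty<\infty$, set $\psi(z)=\tfrac12 z^2+\psi_b(z)$, and let $R\in\mathbb{N}$ and $\delta>0$. Then there is a constant $C\in(0,\infty)$, depending only on $\psi_b$, $R$ and $\delta$, such that the following holds for every $N\ge 1$, every $s\in\mathbb{R}^N$, every $\sigma\in\mathbb{R}$ and every real matrix $M=(M_{ij})_{1\le i,j\le N}$, with off-diagonal entries of arbitrary sign, that satisfies $M_{ii}=1$ and $M_{ij}=M_{ji}$ for all $i,j$, $M_{ij}=0$ whenever $|i-j|>R$, and $$\sum_{j:\,1\le|j-i|\le R}|M_{ij}|+\delta\le M_{ii}=1\qquad\text{for all } 1\le i\le N.$$ Let $$H(x)=\sum_{i=1}^N\Big(\psi(x_i)+s_ix_i+\tfrac12\sum_{j:\,1\le|j-i|\le R}M_{ij}x_ix_j\Big),\qquad x\in\mathbb{R}^N,$$ where $j$ ranges over $\{1,\dots,N\}$. Then the grand canonical ensemble $$\mu^\sigma(dx)=\frac1Z\exp\Big(\sigma\sum_{k=1}^Nx_k-H(x)\Big)dx$$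 is a well-defined probability measure on $\mathbb{R}^N$, the sum $\sum_{k=1}^N X_k$ of the coordinates of $X\sim\mu^\sigma$ is square integrable, and $$\frac1C\le\frac1N\operatorname{Var}_{\mu^\sigma}\Big(\sum_{k=1}^NX_k\Big)\le C.$$ -/

import Mathlib

open MeasureTheory ProbabilityTheory

noncomputable section

namespace SpinSystem

/-- The perturbation `ψb` of the quadratic single-site potential: it is twice differentiable and
`|ψb|_∞ + |ψb'|_∞ + |ψb''|_∞ < ∞`. -/
structure IsBoundedPerturbation (ψb : ℝ → ℝ) : Prop where
  differentiable : Differentiable ℝ ψb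
  differentiable_deriv : Differentiable ℝ (deriv ψb)
  bounded : ∃ K : ℝ, ∀ z : ℝ, |ψb z| ≤ K
  bounded_deriv : ∃ K : ℝ, ∀ z : ℝ, |deriv ψb z| ≤ K
  bounded_deriv_deriv : ∃ K : ℝ, ∀ z : ℝ, |deriv (deriv ψb) z| ≤ K

/-- The sites `j` with `1 ≤ |j - i| ≤ R`. -/
def neighbors {N : ℕ} (R : ℕ) (i : Fin N) : Finset (Fin N) :=
  Finset.univ.filter fun j : Fin N =>
    1 ≤ |((j : ℕ) : ℤ) - ((i : ℕ) : ℤ)| ∧ |((j : ℕ) : ℤ) - ((i : ℕ) : ℤ)| ≤ (R : ℤ)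

/-- Symmetric interaction matrices of range `R`, with unit diagonal, that are strictly diagonally
dominant with margin `δ`. The off-diagonal entries may have any sign. -/
structure IsInteraction (R : ℕ) (δ : ℝ) {N : ℕ} (M : Matrix (Fin N) (Fin N) ℝ) : Prop where
  diag : ∀ i, M i i = 1
  symm : ∀ i j, M i j = M j i
  range : ∀ i j : Fin N, (R : ℤ) < |((i : ℕ) : ℤ) - ((j : ℕ) : ℤ)| → M i j = 0
  dominant : ∀ i, ∑ j ∈ neighbors R i, |M i j| + δ ≤ M i i

/-- The single-site potential `ψ(z) = z² / 2 + ψb(z)`. -/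
def singleSite (ψb : ℝ → ℝ) (z : ℝ) : ℝ := 1 / 2 * z ^ 2 + ψb z

/-- `H(x) = ∑ i, (ψ(x i) + s i * x i + (1/2) ∑_{j : 1 ≤ |j - i| ≤ R} M i j * x i * x j)`. -/
def hamiltonian (ψb : ℝ → ℝ) (R : ℕ) {N : ℕ} (M : Matrix (Fin N) (Fin N) ℝ) (s : Fin N → ℝ)
    (x : Fin N → ℝ) : ℝ :=
  ∑ i, (singleSite ψb (x i) + s i * x i + 1 / 2 * ∑ j ∈ neighbors R i, M i j * x i * x j)

/-- The grand canonical ensemble `μ^σ(dx) = Z⁻¹ exp(σ ∑ k, x k - H(x)) dx` on `ℝ^N`, where `dx` is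
Lebesgue measure and `Z = ∫ exp(σ ∑ k, x k - H(x)) dx`. -/
def gce (ψb : ℝ → ℝ) (R : ℕ) {N : ℕ} (M : Matrix (Fin N) (Fin N) ℝ) (s : Fin N → ℝ) (σ : ℝ) :
    Measure (Fin N → ℝ) :=
  (volume : Measure (Fin N → ℝ)).tilted fun x => σ * ∑ k, x k - hamiltonian ψb R M s x

end SpinSystem

end

/-!
All the Gibbs measures obtained by freezing some of the spins are studied at once, with constants
that do not depend on the number of sites or on the frozen spins.

*Lower bound* (Cramér–Rao). Write `∂ᵢH` for the force on the spin `i`. Integration by parts gives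
`cov (∑ₖ xₖ) (∂ᵢH) = 1` and `Var (∑ᵢ ∂ᵢH) = E (∑ᵢⱼ ∂ᵢⱼH) ≤ (2 + K) N`, where `K` bounds `|ψb''|`. By
Cauchy–Schwarz, `N² ≤ (2 + K) N Var (∑ₖ xₖ)`.

*Upper bound.* A diagonally dominant linear system obeys a maximum principle. Applied to covariances
with a fixed spin, it bounds the variance of each spin; applied to the response of the mean spins to
a frozen spin, it shows that the marginal density of a spin is log-concave up to a bounded
perturbation of the logarithmic derivative. By Hardy's inequality such a marginal satisfies a
Poincaré inequality, from which revealing one more spin reduces the variance of a function of the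
other spins by at most a constant factor `κ`. By the Markov property, a function of the sites to the
right of a cut depends on the sites to the left of it only through the `r` layers next to the cut,
so conditioning it on the left contracts its variance by the factor `1 - κ⁻ʳ`. Hence the response of
the total spin to the right of a cut to the spins on the left has bounded variance, uniformly in the
length of the chain, and each block of `r` sites adds at most a constant to the variance of the
total spin. Here spins are truncated so that all functions are bounded, and the truncation is
removed at the end.
-/

noncomputable section

namespace SpinSystem

open Finset Function

section DominantMatrix

variable {ι : Type*} [Fintype ι]

/-- Symmetric matrices with unit diagonal and absolute row sums, diagonal entry included, at most
`2 - δ`; that is, diagonally dominant with margin `δ`. -/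
structure IsDominant (δ : ℝ) (M : Matrix ι ι ℝ) : Prop where
  diag : ∀ i, M i i = 1
  symm : ∀ i j, M i j = M j i
  row : ∀ i, ∑ j, |M i j| ≤ 2 - δ

namespace IsDominant

variable {δ : ℝ} {M : Matrix ι ι ℝ}

lemma sum_abs_mul_add_sq_le (hM : IsDominant δ M) (x : ι → ℝ) :
    ∑ i, ∑ j, |M i j| * ((x i ^ 2 + x j ^ 2) / 2) ≤ (2 - δ) * ∑ i, x i ^ 2 := by
  have hswap : ∑ i, ∑ j, |M i j| * x j ^ 2 = ∑ i, ∑ j, |M i j| * x i ^ 2 := by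
    rw [sum_comm]
    simp only [hM.symm]
  calc ∑ i, ∑ j, |M i j| * ((x i ^ 2 + x j ^ 2) / 2)
      = (∑ i, ∑ j, |M i j| * x i ^ 2 + ∑ i, ∑ j, |M i j| * x j ^ 2) / 2 := by
        simp only [← sum_add_distrib, sum_div]
        exact sum_congr rfl fun i _ ↦ sum_congr rfl fun j _ ↦ by ring
    _ = ∑ i, (∑ j, |M i j|) * x i ^ 2 := by
        rw [hswap, add_self_div_two]
        simp only [sum_mul]
    _ ≤ (2 - δ) * ∑ i, x i ^ 2 := by
        rw [mul_sum]
        gcongr with i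
        exact hM.row i

lemma mul_sum_sq_le (hM : IsDominant δ M) (x : ι → ℝ) :
    δ * ∑ i, x i ^ 2 ≤ ∑ i, ∑ j, M i j * (x i * x j) := by
  have hpair (i j : ι) : 0 ≤ M i j * (x i * x j) + |M i j| * ((x i ^ 2 + x j ^ 2) / 2) := by
    have hxy : |x i * x j| ≤ (x i ^ 2 + x j ^ 2) / 2 :=
      abs_le.2 ⟨by nlinarith [sq_nonneg (x i + x j)], by nlinarith [sq_nonneg (x i - x j)]⟩
    have := mul_le_mul_of_nonneg_left hxy (abs_nonneg (M i j))
    rw [← abs_mul] at this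
    linarith [neg_abs_le (M i j * (x i * x j))]
  have hdiag (i : ι) :
      2 * x i ^ 2 ≤ ∑ j, (M i j * (x i * x j) + |M i j| * ((x i ^ 2 + x j ^ 2) / 2)) := by
    refine le_trans (le_of_eq ?_) (single_le_sum (fun j _ ↦ hpair i j) (mem_univ i))
    rw [hM.diag, abs_one]
    ring
  have hsum := sum_le_sum fun i (_ : i ∈ univ) ↦ hdiag i
  simp only [sum_add_distrib, ← mul_sum] at hsum
  linarith [hM.sum_abs_mul_add_sq_le x]

lemma abs_sum_erase_mul_le [DecidableEq ι] (hM : IsDominant δ M) (i : ι) {d : ι → ℝ} {B : ℝ}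
    (hB : 0 ≤ B) (hd : ∀ j, j ≠ i → |d j| ≤ B) :
    |∑ j ∈ univ.erase i, M i j * d j| ≤ (1 - δ) * B := by
  have hrow : ∑ j ∈ univ.erase i, |M i j| ≤ 1 - δ := by
    have := hM.row i
    rw [← add_sum_erase _ _ (mem_univ i), hM.diag, abs_one] at this
    linarith
  calc |∑ j ∈ univ.erase i, M i j * d j|
      ≤ ∑ j ∈ univ.erase i, |M i j| * |d j| := by
        simpa only [abs_mul] using abs_sum_le_sum_abs (fun j ↦ M i j * d j) (univ.erase i)
    _ ≤ (∑ j ∈ univ.erase i, |M i j|) * B := by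
        rw [sum_mul]
        exact sum_le_sum fun j hj ↦
          mul_le_mul_of_nonneg_left (hd j (ne_of_mem_erase hj)) (abs_nonneg _)
    _ ≤ (1 - δ) * B := mul_le_mul_of_nonneg_right hrow hB

lemma abs_le_of_abs_sum_mul_le (hδ : 0 < δ) (hM : IsDominant δ M) {d : ι → ℝ}
    {a b : ℝ} (ha : 0 ≤ a) (hb : 0 ≤ b) (h : ∀ i, |d i| ≤ a ∨ |∑ j, M i j * d j| ≤ b) (i : ι) :
    |d i| ≤ a + b / δ := by
  classical
  obtain ⟨k, -, hk⟩ := exists_max_image univ (fun j ↦ |d j|) ⟨i, mem_univ i⟩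
  refine (hk i (mem_univ i)).trans ?_
  have hbδ : 0 ≤ b / δ := by positivity
  rcases h k with h | h
  · linarith
  · rw [← add_sum_erase _ _ (mem_univ k), hM.diag, one_mul] at h
    have hoff := hM.abs_sum_erase_mul_le k (abs_nonneg (d k)) fun j _ ↦ hk j (mem_univ j)
    have htri := abs_sub (d k + ∑ j ∈ univ.erase k, M k j * d j) (∑ j ∈ univ.erase k, M k j * d j)
    rw [add_sub_cancel_right] at htri
    have : |d k| ≤ b / δ := by
      rw [le_div_iff₀ hδ]
      linarith
    linarith

end IsDominant

end DominantMatrix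

section Variance

variable {Ω : Type*} {mΩ : MeasurableSpace Ω} {μ : Measure Ω} {X Y : Ω → ℝ}

variable [IsProbabilityMeasure μ]

lemma variance_eq_zero_of_ae_eq_const {c : ℝ} (h : X =ᵐ[μ] fun _ ↦ c) : Var[X; μ] = 0 := by
  rw [variance_congr h, variance_eq_integral aemeasurable_const]
  simp

lemma covariance_sq_le (hX : MemLp X 2 μ) (hY : MemLp Y 2 μ) :
    cov[X, Y; μ] ^ 2 ≤ Var[X; μ] * Var[Y; μ] := by
  have hnonneg (a : ℝ) : 0 ≤ Var[X; μ] * (a * a) + 2 * cov[X, Y; μ] * a + Var[Y; μ] := by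
    have := variance_nonneg (fun ω ↦ a * X ω + Y ω) μ
    rw [variance_fun_add (hX.const_mul a) hY, variance_const_mul, covariance_const_mul_left] at this
    linarith
  have := discrim_le_zero hnonneg
  rw [discrim] at this
  linarith

lemma abs_covariance_le (hX : MemLp X 2 μ) (hY : MemLp Y 2 μ) :
    |cov[X, Y; μ]| ≤ √Var[X; μ] * √Var[Y; μ] := by
  rw [← Real.sqrt_mul (variance_nonneg _ _), ← Real.sqrt_sq_eq_abs]
  exact Real.sqrt_le_sqrt (covariance_sq_le hX hY)

lemma sqrt_variance_add_le (hX : MemLp X 2 μ) (hY : MemLp Y 2 μ) :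
    √Var[fun ω ↦ X ω + Y ω; μ] ≤ √Var[X; μ] + √Var[Y; μ] := by
  refine Real.sqrt_le_iff.2 ⟨by positivity, ?_⟩
  rw [variance_fun_add hX hY]
  have := (le_abs_self _).trans (abs_covariance_le hX hY)
  linarith [add_sq √Var[X; μ] √Var[Y; μ], Real.sq_sqrt (variance_nonneg X μ),
    Real.sq_sqrt (variance_nonneg Y μ)]

lemma sqrt_variance_sum_le {κ : Type*} (t : Finset κ) {X : κ → Ω → ℝ}
    (hX : ∀ k ∈ t, MemLp (X k) 2 μ) :
    √Var[fun ω ↦ ∑ k ∈ t, X k ω; μ] ≤ ∑ k ∈ t, √Var[X k; μ] := by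
  classical
  induction t using Finset.induction_on with
  | empty => simp [variance_eq_zero_of_ae_eq_const (X := fun _ : Ω ↦ (0 : ℝ)) (ae_eq_refl _)]
  | insert a t ha ih =>
    simp only [sum_insert ha]
    have ht (k) (hk : k ∈ t) := hX k (mem_insert_of_mem hk)
    exact (sqrt_variance_add_le (hX a (mem_insert_self _ _)) (memLp_finsetSum t ht)).trans
      (by gcongr; exact ih ht)

lemma variance_le_integral_sub_sq (hX : AEStronglyMeasurable X μ) (c : ℝ) :
    Var[X; μ] ≤ ∫ ω, (X ω - c) ^ 2 ∂μ := by
  rw [← variance_sub_const hX c]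
  exact variance_le_expectation_sq (hX.sub aestronglyMeasurable_const)

lemma variance_comp_le_of_lipschitzWith {φ : ℝ → ℝ} {L : NNReal} (hφ : LipschitzWith L φ)
    (hX : MemLp X 2 μ) : Var[fun ω ↦ φ (X ω); μ] ≤ L ^ 2 * Var[X; μ] := by
  have hcenter : Integrable (fun ω ↦ (X ω - μ[X]) ^ 2) μ :=
    (hX.sub (memLp_const _)).integrable_sq
  rw [variance_eq_integral hX.aestronglyMeasurable.aemeasurable, ← integral_const_mul]
  refine (variance_le_integral_sub_sq (hφ.continuous.comp_aestronglyMeasurable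
    hX.aestronglyMeasurable) (φ μ[X])).trans ?_
  refine integral_mono_of_nonneg (Filter.Eventually.of_forall fun ω ↦ sq_nonneg _)
    (hcenter.const_mul _) (Filter.Eventually.of_forall fun ω ↦ ?_)
  have hdist : |φ (X ω) - φ μ[X]| ≤ L * |X ω - μ[X]| := hφ.dist_le_mul _ _
  calc (φ (X ω) - φ μ[X]) ^ 2 = |φ (X ω) - φ μ[X]| ^ 2 := (sq_abs _).symm
    _ ≤ (L * |X ω - μ[X]|) ^ 2 := pow_le_pow_left₀ (abs_nonneg _) hdist 2
    _ = L ^ 2 * (X ω - μ[X]) ^ 2 := by rw [mul_pow, sq_abs]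

lemma tendsto_variance_of_dominated {F : ℕ → Ω → ℝ} {bound : Ω → ℝ}
    (hF : ∀ n, AEStronglyMeasurable (F n) μ) (hbound : MemLp bound 2 μ)
    (hle : ∀ n, ∀ᵐ ω ∂μ, |F n ω| ≤ bound ω)
    (hlim : ∀ᵐ ω ∂μ, Filter.Tendsto (fun n ↦ F n ω) Filter.atTop (nhds (X ω))) :
    Filter.Tendsto (fun n ↦ Var[F n; μ]) Filter.atTop (nhds Var[X; μ]) := by
  have hX : MemLp X 2 μ := by
    refine hbound.mono' (aestronglyMeasurable_of_tendsto_ae _ hF hlim) ?_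
    filter_upwards [ae_all_iff.2 hle, hlim] with ω hω hlimω
    exact le_of_tendsto hlimω.abs (Filter.Eventually.of_forall hω)
  have hmean := tendsto_integral_of_dominated_convergence bound hF
    (hbound.integrable one_le_two) hle hlim
  have hsq := tendsto_integral_of_dominated_convergence (F := fun n ω ↦ F n ω ^ 2)
    (fun ω ↦ bound ω ^ 2) (fun n ↦ (hF n).pow 2) hbound.integrable_sq
    (fun n ↦ (hle n).mono fun ω hω ↦ by
      rw [Real.norm_eq_abs, abs_pow]
      exact pow_le_pow_left₀ (abs_nonneg _) hω 2)
    (hlim.mono fun ω hω ↦ hω.pow 2)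
  have hvar (n : ℕ) : Var[F n; μ] = ∫ ω, F n ω ^ 2 ∂μ - (∫ ω, F n ω ∂μ) ^ 2 :=
    variance_eq_sub (hbound.mono' (hF n) (hle n))
  simp only [hvar, variance_eq_sub hX]
  exact hsq.sub (hmean.pow 2)

end Variance

section Hardy

variable {p f f' : ℝ → ℝ} {a C : ℝ}

lemma hasDerivAt_integral_Ioi (hpc : Continuous p) (hpi : Integrable p) (t : ℝ) :
    HasDerivAt (fun t ↦ ∫ u in Set.Ioi t, p u) (-p t) t := by
  have hsplit : (fun t ↦ ∫ u in Set.Ioi t, p u)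
      = fun t ↦ (∫ u in Set.Ioi 0, p u) - ∫ u in (0 : ℝ)..t, p u := by
    ext t
    have := intervalIntegral.integral_interval_add_Ioi (a := 0) (b := t)
      hpi.integrableOn hpi.integrableOn
    linarith
  rw [hsplit]
  exact (hpc.integral_hasStrictDerivAt 0 t).hasDerivAt.const_sub _

lemma abs_two_mul_mul_mul_le {g h T q : ℝ} (hq : 0 ≤ q) (hT : 0 ≤ T) (hTq : T ≤ C * q) :
    |2 * g * h * T| ≤ 1 / 2 * (g ^ 2 * q) + 2 * C ^ 2 * (h ^ 2 * q) := by
  have hyoung : 2 * |g| * |h| * C ≤ 1 / 2 * g ^ 2 + 2 * C ^ 2 * h ^ 2 := by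
    rw [← sq_abs g, ← sq_abs h]
    nlinarith [sq_nonneg (|g| - 2 * C * |h|)]
  calc |2 * g * h * T| = 2 * |g| * |h| * T := by
        rw [abs_mul, abs_of_nonneg hT, abs_mul, abs_mul, abs_two]
    _ ≤ 2 * |g| * |h| * (C * q) := by gcongr
    _ = 2 * |g| * |h| * C * q := by ring
    _ ≤ (1 / 2 * g ^ 2 + 2 * C ^ 2 * h ^ 2) * q := by gcongr
    _ = 1 / 2 * (g ^ 2 * q) + 2 * C ^ 2 * (h ^ 2 * q) := by ring

variable (hp : ∀ t, 0 ≤ p t) (hpc : Continuous p) (hpi : Integrable p)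
  (htail : ∀ t, a ≤ t → ∫ u in Set.Ioi t, p u ≤ C * p t) (hf : ∀ t, HasDerivAt f (f' t) t)
include hp hpc hpi htail hf

lemma intervalIntegral_sub_sq_mul_le {b : ℝ} (hab : a ≤ b)
    (hf' : IntervalIntegrable (fun t ↦ f' t ^ 2 * p t) volume a b) :
    ∫ t in a..b, (f t - f a) ^ 2 * p t ≤ 4 * C ^ 2 * ∫ t in a..b, f' t ^ 2 * p t := by
  set T : ℝ → ℝ := fun t ↦ ∫ u in Set.Ioi t, p u
  have hT (t : ℝ) : 0 ≤ T t := integral_nonneg hp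
  have hfc : Continuous f := continuous_iff_continuousAt.2 fun t ↦ (hf t).continuousAt
  have hTc : Continuous T :=
    continuous_iff_continuousAt.2 fun t ↦ (hasDerivAt_integral_Ioi hpc hpi t).continuousAt
  have hf'm : Measurable f' := by
    rw [funext fun t ↦ (hf t).deriv.symm]
    exact measurable_deriv f
  have hint : IntervalIntegrable (fun t ↦ (f t - f a) ^ 2 * p t) volume a b :=
    (by fun_prop : Continuous fun t ↦ (f t - f a) ^ 2 * p t).intervalIntegrable a b
  have hmajor := (hint.const_mul (1 / 2)).add (hf'.const_mul (2 * C ^ 2))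
  have hcross (t : ℝ) (ht : t ∈ Set.Icc a b) := abs_two_mul_mul_mul_le (g := f t - f a)
    (h := f' t) (hp t) (hT t) (htail t ht.1)
  have hcrossInt : IntervalIntegrable (fun t ↦ 2 * (f t - f a) * f' t * T t) volume a b := by
    refine hmajor.mono_fun' (by fun_prop) ?_
    rw [Set.uIoc_of_le hab]
    exact ae_restrict_of_forall_mem measurableSet_Ioc fun t ht ↦
      hcross t (Set.Ioc_subset_Icc_self ht)
  have hFTC := intervalIntegral.integral_eq_sub_of_hasDerivAt (a := a) (b := b)
    (f := fun t ↦ (f t - f a) ^ 2 * T t)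
    (f' := fun t ↦ 2 * (f t - f a) * f' t * T t - (f t - f a) ^ 2 * p t)
    (fun t _ ↦ ((((hf t).sub_const (f a)).fun_pow 2).mul
      (hasDerivAt_integral_Ioi hpc hpi t)).congr_deriv (by push_cast; ring))
    (hcrossInt.sub hint)
  rw [intervalIntegral.integral_sub hcrossInt hint] at hFTC
  have hle := intervalIntegral.integral_mono_on hab hcrossInt hmajor
    fun t ht ↦ (le_abs_self _).trans (hcross t ht)
  rw [intervalIntegral.integral_add (hint.const_mul _) (hf'.const_mul _),
    intervalIntegral.integral_const_mul, intervalIntegral.integral_const_mul] at hle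
  have hboundary : 0 ≤ (f b - f a) ^ 2 * T b := mul_nonneg (sq_nonneg _) (hT b)
  simp only [sub_self] at hFTC
  linarith

theorem hardy_inequality (hf' : IntegrableOn (fun t ↦ f' t ^ 2 * p t) (Set.Ioi a)) :
    IntegrableOn (fun t ↦ (f t - f a) ^ 2 * p t) (Set.Ioi a) ∧
      ∫ t in Set.Ioi a, (f t - f a) ^ 2 * p t
        ≤ 4 * C ^ 2 * ∫ t in Set.Ioi a, f' t ^ 2 * p t := by
  have hfc : Continuous f := continuous_iff_continuousAt.2 fun t ↦ (hf t).continuousAt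
  have hcont : Continuous fun t ↦ (f t - f a) ^ 2 * p t := by fun_prop
  have hle : ∀ᶠ b in Filter.atTop, ∫ t in a..b, (f t - f a) ^ 2 * p t
      ≤ 4 * C ^ 2 * ∫ t in Set.Ioi a, f' t ^ 2 * p t := by
    filter_upwards [Filter.eventually_ge_atTop a] with b hab
    refine (intervalIntegral_sub_sq_mul_le hp hpc hpi htail hf hab
      ((intervalIntegrable_iff_integrableOn_Ioc_of_le hab).2
        (hf'.mono_set Set.Ioc_subset_Ioi_self))).trans ?_
    rw [intervalIntegral.integral_of_le hab]
    gcongr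
    · exact Filter.Eventually.of_forall fun t ↦ mul_nonneg (sq_nonneg _) (hp t)
    · exact Set.Ioc_subset_Ioi_self
  have hint : IntegrableOn (fun t ↦ (f t - f a) ^ 2 * p t) (Set.Ioi a) :=
    integrableOn_Ioi_of_intervalIntegral_norm_bounded _ a
      (fun b ↦ hcont.integrableOn_Ioc) Filter.tendsto_id <| hle.mono fun b hb ↦ by
        simpa only [Real.norm_of_nonneg (mul_nonneg (sq_nonneg _) (hp _)), id] using hb
  exact ⟨hint, le_of_tendsto (intervalIntegral_tendsto_integral_Ioi a hint Filter.tendsto_id) hle⟩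

end Hardy

section NearlyLogConcave

lemma integrable_exp_mul_abs_sub_mul_sq {a : ℝ} (ha : 0 < a) (b : ℝ) :
    Integrable fun t : ℝ ↦ Real.exp (b * |t| - a * t ^ 2) := by
  have hgauss := (integrable_exp_neg_mul_sq (half_pos ha)).const_mul (Real.exp (b ^ 2 / (2 * a)))
  refine hgauss.mono' (by fun_prop) (Filter.Eventually.of_forall fun t ↦ ?_)
  rw [Real.norm_eq_abs, Real.abs_exp, ← Real.exp_add, Real.exp_le_exp]
  have hsquare : b ^ 2 / (2 * a) - b * |t| + a / 2 * t ^ 2 = (b - a * |t|) ^ 2 / (2 * a) := by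
    rw [← sq_abs t]
    field_simp
    ring
  have : 0 ≤ (b - a * |t|) ^ 2 / (2 * a) := by positivity
  linarith

/-- Positive integrable densities `p = exp (-U)` whose potential `U` has a derivative `V` that is,
up to the error `L`, increasing with slope `δ`. -/
structure IsNearlyLogConcave (δ L : ℝ) (p V : ℝ → ℝ) : Prop where
  pos : ∀ t, 0 < p t
  integrable : Integrable p
  hasDerivAt : ∀ t, HasDerivAt p (-(V t * p t)) t
  increment : ∀ t t', t ≤ t' → δ * (t' - t) - L ≤ V t' - V t

/-- The bound on the ratio of the tail `∫ u in Ioi t, p u` to `p t` for densities that are nearly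
log-concave with parameters `δ` and `L`. -/
def tailRatio (δ L : ℝ) : ℝ := ∫ h : ℝ, Real.exp (L * |h| - δ / 2 * h ^ 2)

namespace IsNearlyLogConcave

variable {δ L t₀ : ℝ} {p V : ℝ → ℝ}

lemma continuous (hp : IsNearlyLogConcave δ L p V) : Continuous p :=
  continuous_iff_continuousAt.2 fun t ↦ (hp.hasDerivAt t).continuousAt

lemma hasDerivAt_log (hp : IsNearlyLogConcave δ L p V) (t : ℝ) :
    HasDerivAt (fun t ↦ Real.log (p t)) (-V t) t := by
  refine ((hp.hasDerivAt t).log (hp.pos t).ne').congr_deriv ?_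
  have := (hp.pos t).ne'
  field_simp

lemma reflect (hp : IsNearlyLogConcave δ L p V) :
    IsNearlyLogConcave δ L (fun t ↦ p (-t)) fun t ↦ -V (-t) where
  pos t := hp.pos _
  integrable := hp.integrable.comp_neg
  hasDerivAt t := ((hp.hasDerivAt (-t)).scomp t (hasDerivAt_neg t)).congr_deriv (by simp)
  increment t t' h := by linarith [hp.increment (-t') (-t) (by linarith)]

lemma exists_eq_zero (hδ : 0 < δ) (hp : IsNearlyLogConcave δ L p V) : ∃ t₀, V t₀ = 0 := by
  set b := (|L| + |V 0| + 1) / δ with hb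
  have hb0 : 0 ≤ b := by positivity
  have hδb : δ * b = |L| + |V 0| + 1 := by
    rw [hb]
    field_simp
  have hright := hp.increment 0 b hb0
  have hleft := hp.increment (-b) 0 (by linarith)
  have hV0 := abs_le.1 (le_refl |V 0|)
  have hL := le_abs_self L
  obtain ⟨t, -, ht⟩ := exists_hasDerivWithinAt_eq_of_gt_of_lt (a := -b) (b := b) (m := 0)
    (by linarith) (fun x _ ↦ (hp.hasDerivAt_log x).neg.hasDerivWithinAt)
    (by linarith) (by linarith)
  exact ⟨t, by simpa using ht⟩

lemma le_mul_exp (hδ : 0 ≤ δ) (hp : IsNearlyLogConcave δ L p V) (h₀ : V t₀ = 0) {t u : ℝ}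
    (ht : t₀ ≤ t) (hu : t ≤ u) :
    p u ≤ p t * Real.exp (L * (u - t) - δ / 2 * (u - t) ^ 2) := by
  set q : ℝ → ℝ := fun v ↦ Real.log (p v) - (L * (v - t) - δ / 2 * (v - t) ^ 2)
  have hq (v : ℝ) : HasDerivAt q (-V v - (L - δ * (v - t))) v := by
    have hid : HasDerivAt (fun v : ℝ ↦ v - t) 1 v := (hasDerivAt_id v).sub_const t
    exact ((hp.hasDerivAt_log v).sub ((hid.const_mul L).sub
      ((hid.fun_pow 2).const_mul (δ / 2)))).congr_deriv (by push_cast; ring)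
  have hanti : AntitoneOn q (Set.Ici t) := by
    refine antitoneOn_of_deriv_nonpos (convex_Ici t)
      (fun v _ ↦ (hq v).continuousAt.continuousWithinAt)
      (fun v _ ↦ (hq v).differentiableAt.differentiableWithinAt) fun v hv ↦ ?_
    rw [interior_Ici, Set.mem_Ioi] at hv
    rw [(hq v).deriv]
    have hinc := hp.increment t₀ v (by linarith)
    have : δ * (v - t) ≤ δ * (v - t₀) := by gcongr
    linarith
  have hle := hanti Set.self_mem_Ici hu hu
  simp only [q, sub_self] at hle
  calc p u = Real.exp (Real.log (p u)) := (Real.exp_log (hp.pos u)).symm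
    _ ≤ Real.exp (Real.log (p t) + (L * (u - t) - δ / 2 * (u - t) ^ 2)) :=
        Real.exp_le_exp.2 (by linarith)
    _ = p t * Real.exp (L * (u - t) - δ / 2 * (u - t) ^ 2) := by
        rw [Real.exp_add, Real.exp_log (hp.pos t)]

lemma integral_Ioi_le (hδ : 0 < δ) (hp : IsNearlyLogConcave δ L p V) (h₀ : V t₀ = 0) {t : ℝ}
    (ht : t₀ ≤ t) : ∫ u in Set.Ioi t, p u ≤ tailRatio δ L * p t := by
  set k : ℝ → ℝ := fun h ↦ Real.exp (L * |h| - δ / 2 * h ^ 2)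
  have hk : Integrable fun u ↦ p t * k (u - t) :=
    ((integrable_exp_mul_abs_sub_mul_sq (half_pos hδ) L).comp_sub_right t).const_mul (p t)
  calc ∫ u in Set.Ioi t, p u
      ≤ ∫ u in Set.Ioi t, p t * k (u - t) := by
        refine setIntegral_mono_on hp.integrable.integrableOn hk.integrableOn measurableSet_Ioi
          fun u (hu : t < u) ↦ ?_
        simpa only [k, abs_of_pos (sub_pos.2 hu)] using hp.le_mul_exp hδ.le h₀ ht hu.le
    _ ≤ ∫ u, p t * k (u - t) :=
        setIntegral_le_integral hk (Filter.Eventually.of_forall fun u ↦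
          mul_nonneg (hp.pos t).le (Real.exp_pos _).le)
    _ = tailRatio δ L * p t := by
        rw [integral_const_mul, integral_sub_right_eq_self k t, mul_comm, tailRatio]

theorem poincare (hδ : 0 < δ) (hp : IsNearlyLogConcave δ L p V) {f f' : ℝ → ℝ}
    (hf : ∀ t, HasDerivAt f (f' t) t) (hf' : Integrable fun t ↦ f' t ^ 2 * p t) :
    ∃ c, ∫ t, (f t - c) ^ 2 * p t ≤ 4 * tailRatio δ L ^ 2 * ∫ t, f' t ^ 2 * p t := by
  obtain ⟨t₀, h₀⟩ := hp.exists_eq_zero hδ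
  obtain ⟨hintR, hright⟩ := hardy_inequality (fun t ↦ (hp.pos t).le) hp.continuous hp.integrable
    (fun t ht ↦ hp.integral_Ioi_le hδ h₀ ht) hf hf'.integrableOn
  obtain ⟨hintL, hleft⟩ := hardy_inequality (a := -t₀) (f := fun t ↦ f (-t))
    (f' := fun t ↦ -f' (-t)) (fun t ↦ (hp.pos (-t)).le) hp.reflect.continuous hp.reflect.integrable
    (fun t ht ↦ hp.reflect.integral_Ioi_le hδ (by simpa using h₀) ht)
    (fun t ↦ ((hf (-t)).scomp t (hasDerivAt_neg t)).congr_deriv (by simp))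
    (by simpa only [neg_sq] using hf'.comp_neg.integrableOn)
  simp only [neg_neg, neg_sq] at hintL hleft
  have hintL' : IntegrableOn (fun t ↦ (f t - f t₀) ^ 2 * p t) (Set.Iic t₀) := by
    rw [← integrableOn_Ici_iff_integrableOn_Ioi] at hintL
    simpa using hintL.comp_neg_Iic
  rw [← integral_comp_neg_Iic t₀ fun t ↦ (f (-t) - f t₀) ^ 2 * p (-t),
    ← integral_comp_neg_Iic t₀ fun t ↦ f' (-t) ^ 2 * p (-t)] at hleft
  simp only [neg_neg] at hleft
  refine ⟨f t₀, ?_⟩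
  rw [← intervalIntegral.integral_Iic_add_Ioi hintL' hintR,
    ← intervalIntegral.integral_Iic_add_Ioi hf'.integrableOn hf'.integrableOn (b := t₀), mul_add]
  exact add_le_add hleft hright

end IsNearlyLogConcave

end NearlyLogConcave

section Tame

variable {ι : Type*} [Fintype ι]

/-- Measurable functions of at most exponential growth; they are integrable for every measure whose
density has Gaussian tails. -/
structure IsTame (F : (ι → ℝ) → ℝ) : Prop where
  measurable : Measurable F
  growth : ∃ C ≥ 0, ∃ c ≥ 0, ∀ x, |F x| ≤ C * Real.exp (c * ∑ i, |x i|)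

/-- Bounded measurable real functions. -/
structure IsBoundedMeasurable {α : Type*} [MeasurableSpace α] (g : α → ℝ) : Prop where
  measurable : Measurable g
  bounded : ∃ C, ∀ x, |g x| ≤ C

namespace IsBoundedMeasurable

variable {α : Type*} [MeasurableSpace α] {f g : α → ℝ}

lemma const (c : ℝ) : IsBoundedMeasurable fun _ : α ↦ c :=
  ⟨measurable_const, |c|, fun _ ↦ le_rfl⟩

lemma add (hf : IsBoundedMeasurable f) (hg : IsBoundedMeasurable g) :
    IsBoundedMeasurable fun x ↦ f x + g x := by
  obtain ⟨C, hC⟩ := hf.bounded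
  obtain ⟨D, hD⟩ := hg.bounded
  exact ⟨hf.measurable.add hg.measurable, C + D,
    fun x ↦ (abs_add_le _ _).trans (add_le_add (hC x) (hD x))⟩

lemma sub (hf : IsBoundedMeasurable f) (hg : IsBoundedMeasurable g) :
    IsBoundedMeasurable fun x ↦ f x - g x := by
  obtain ⟨C, hC⟩ := hf.bounded
  obtain ⟨D, hD⟩ := hg.bounded
  exact ⟨hf.measurable.sub hg.measurable, C + D,
    fun x ↦ (abs_sub _ _).trans (add_le_add (hC x) (hD x))⟩

lemma mul (hf : IsBoundedMeasurable f) (hg : IsBoundedMeasurable g) :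
    IsBoundedMeasurable fun x ↦ f x * g x := by
  obtain ⟨C, hC⟩ := hf.bounded
  obtain ⟨D, hD⟩ := hg.bounded
  refine ⟨hf.measurable.mul hg.measurable, C * D, fun x ↦ ?_⟩
  rw [abs_mul]
  exact mul_le_mul (hC x) (hD x) (abs_nonneg _) ((abs_nonneg _).trans (hC x))

lemma sq (hf : IsBoundedMeasurable f) : IsBoundedMeasurable fun x ↦ f x ^ 2 := by
  simpa only [pow_two] using hf.mul hf

lemma sum {κ : Type*} (t : Finset κ) {f : κ → α → ℝ} (h : ∀ k ∈ t, IsBoundedMeasurable (f k)) :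
    IsBoundedMeasurable fun x ↦ ∑ k ∈ t, f k x := by
  choose! C hC using fun k hk ↦ (h k hk).bounded
  exact ⟨measurable_fun_sum t fun k hk ↦ (h k hk).measurable, ∑ k ∈ t, C k,
    fun x ↦ (abs_sum_le_sum_abs _ _).trans (sum_le_sum fun k hk ↦ hC k hk x)⟩

lemma isTame {F : (ι → ℝ) → ℝ} (hF : IsBoundedMeasurable F) : IsTame F := by
  obtain ⟨C, hC⟩ := hF.bounded
  exact ⟨hF.measurable, |C|, abs_nonneg C, 0, le_rfl,
    fun x ↦ by simpa using (hC x).trans (le_abs_self C)⟩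

end IsBoundedMeasurable

namespace IsTame

variable {F G : (ι → ℝ) → ℝ}

lemma const (c : ℝ) : IsTame fun _ : ι → ℝ ↦ c := (IsBoundedMeasurable.const c).isTame

lemma add (hF : IsTame F) (hG : IsTame G) : IsTame fun x ↦ F x + G x := by
  obtain ⟨C, hC, c, hc, hFC⟩ := hF.growth
  obtain ⟨D, hD, d, hd, hGD⟩ := hG.growth
  refine ⟨hF.measurable.add hG.measurable, C + D, add_nonneg hC hD, c + d, add_nonneg hc hd,
    fun x ↦ ?_⟩
  calc |F x + G x| ≤ |F x| + |G x| := abs_add_le _ _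
    _ ≤ C * Real.exp (c * ∑ i, |x i|) + D * Real.exp (d * ∑ i, |x i|) := add_le_add (hFC x) (hGD x)
    _ ≤ C * Real.exp ((c + d) * ∑ i, |x i|) + D * Real.exp ((c + d) * ∑ i, |x i|) := by
        gcongr <;> linarith
    _ = (C + D) * Real.exp ((c + d) * ∑ i, |x i|) := (add_mul _ _ _).symm

lemma mul (hF : IsTame F) (hG : IsTame G) : IsTame fun x ↦ F x * G x := by
  obtain ⟨C, hC, c, hc, hFC⟩ := hF.growth
  obtain ⟨D, hD, d, hd, hGD⟩ := hG.growth
  refine ⟨hF.measurable.mul hG.measurable, C * D, mul_nonneg hC hD, c + d, add_nonneg hc hd,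
    fun x ↦ ?_⟩
  rw [abs_mul, add_mul, Real.exp_add, mul_mul_mul_comm]
  exact mul_le_mul (hFC x) (hGD x) (abs_nonneg _) (by positivity)

lemma const_mul (hF : IsTame F) (c : ℝ) : IsTame fun x ↦ c * F x := (const c).mul hF

lemma sub (hF : IsTame F) (hG : IsTame G) : IsTame fun x ↦ F x - G x := by
  simpa [sub_eq_add_neg] using hF.add (hG.const_mul (-1))

lemma sum {κ : Type*} (t : Finset κ) {f : κ → (ι → ℝ) → ℝ} (h : ∀ k ∈ t, IsTame (f k)) :
    IsTame fun x ↦ ∑ k ∈ t, f k x := by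
  classical
  induction t using Finset.induction_on with
  | empty => simpa using const (0 : ℝ)
  | insert a t ha ih =>
    simp only [sum_insert ha]
    exact (h a (mem_insert_self _ _)).add (ih fun k hk ↦ h k (mem_insert_of_mem hk))

lemma coord (i : ι) : IsTame fun x : ι → ℝ ↦ x i := by
  refine ⟨measurable_pi_apply i, 1, zero_le_one, 1, zero_le_one, fun x ↦ ?_⟩
  have hle : |x i| ≤ ∑ j, |x j| :=
    single_le_sum (f := fun j ↦ |x j|) (fun j _ ↦ abs_nonneg _) (mem_univ i)
  rw [one_mul, one_mul]
  linarith [Real.add_one_le_exp (∑ j, |x j|)]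

end IsTame

end Tame

section PartialVolume

variable {ι : Type*} [DecidableEq ι]

lemma measurable_piecewise (A : Finset ι) :
    Measurable fun p : (ι → ℝ) × (ι → ℝ) ↦ A.piecewise p.2 p.1 := by
  refine measurable_pi_lambda _ fun i ↦ ?_
  by_cases hi : i ∈ A
  · simpa [hi, comp_def] using (measurable_pi_apply i).comp measurable_snd
  · simpa [hi, comp_def] using (measurable_pi_apply i).comp measurable_fst

lemma measurable_piecewise_left (A : Finset ι) (x : ι → ℝ) :
    Measurable fun z : ι → ℝ ↦ A.piecewise z x :=
  (measurable_piecewise A).comp (measurable_const.prodMk measurable_id)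

lemma measurable_update_const (i : ι) (t : ℝ) : Measurable fun x : ι → ℝ ↦ update x i t :=
  measurable_update'.comp (measurable_id.prodMk measurable_const)

variable [Fintype ι]

/-- Lebesgue measure in the coordinates of `A`, the other coordinates being frozen at `x`. -/
def partialVolume (A : Finset ι) (x : ι → ℝ) : Measure (ι → ℝ) :=
  Measure.pi fun i ↦ if i ∈ A then volume else Measure.dirac (x i)

instance sigmaFinite_ite_volume_dirac (A : Finset ι) (x : ι → ℝ) (i : ι) :
    SigmaFinite (if i ∈ A then volume else Measure.dirac (x i) : Measure ℝ) := by
  split_ifs <;> infer_instance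

instance sigmaFinite_partialVolume (A : Finset ι) (x : ι → ℝ) : SigmaFinite (partialVolume A x) :=
  inferInstanceAs (SigmaFinite (Measure.pi _))

instance neZero_partialVolume (A : Finset ι) (x : ι → ℝ) : NeZero (partialVolume A x) := by
  refine ⟨fun h ↦ ?_⟩
  have huniv : partialVolume A x Set.univ = 0 := by simp [h]
  rw [partialVolume, Measure.pi_univ, prod_eq_zero_iff] at huniv
  obtain ⟨i, -, hi⟩ := huniv
  split_ifs at hi <;> simp at hi

lemma partialVolume_univ (x : ι → ℝ) : partialVolume univ x = volume := by
  simp [partialVolume, volume_pi]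

lemma partialVolume_empty (x : ι → ℝ) : partialVolume ∅ x = Measure.dirac x := by
  refine Measure.pi_eq fun s hs ↦ ?_
  classical
  simp [Measure.dirac_apply' _ (MeasurableSet.univ_pi hs), Measure.dirac_apply' _ (hs _),
    Set.indicator_apply, prod_ite_zero]

lemma partialVolume_congr {A : Finset ι} {x x' : ι → ℝ} (h : ∀ i ∉ A, x i = x' i) :
    partialVolume A x = partialVolume A x' := by
  unfold partialVolume
  congr 1
  ext1 i
  split_ifs with hi
  · rfl
  · rw [h i hi]

variable {A B : Finset ι} {F : (ι → ℝ) → ℝ}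

lemma partialVolume_union (hAB : Disjoint A B) (x x' : ι → ℝ) :
    partialVolume (A ∪ B) x
      = ((partialVolume A x).prod (partialVolume B x')).map fun p ↦ B.piecewise p.2 p.1 := by
  refine Measure.pi_eq fun s hs ↦ ?_
  have hpre : (fun p : (ι → ℝ) × (ι → ℝ) ↦ B.piecewise p.2 p.1) ⁻¹' Set.univ.pi s
      = (Set.univ.pi fun i ↦ if i ∈ B then Set.univ else s i) ×ˢ
        (Set.univ.pi fun i ↦ if i ∈ B then s i else Set.univ) := by
    ext p
    simp only [Set.mem_preimage, Set.mem_univ_pi, Set.mem_prod, ← forall_and]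
    refine forall_congr' fun i ↦ ?_
    by_cases hi : i ∈ B <;> simp [hi]
  rw [Measure.map_apply (measurable_piecewise B) (MeasurableSet.univ_pi hs), hpre,
    Measure.prod_prod, partialVolume, partialVolume, Measure.pi_pi, Measure.pi_pi,
    ← prod_mul_distrib]
  refine prod_congr rfl fun i _ ↦ ?_
  by_cases hi : i ∈ B
  · simp [hi, disjoint_right.1 hAB hi]
  · simp [hi]

lemma partialVolume_eq_map (A : Finset ι) (x x' : ι → ℝ) :
    partialVolume A x = (partialVolume A x').map fun z ↦ A.piecewise z x := by
  have hunion := partialVolume_union (disjoint_empty_left A) x x'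
  rw [empty_union, partialVolume_empty, Measure.dirac_prod,
    Measure.map_map (measurable_piecewise A) measurable_prodMk_left] at hunion
  exact hunion

lemma partialVolume_update {i : ι} (hi : i ∉ A) (x : ι → ℝ) (t : ℝ) :
    partialVolume A (update x i t) = (partialVolume A x).map fun y ↦ update y i t := by
  rw [partialVolume_eq_map A (update x i t) x]
  conv_rhs => rw [partialVolume_eq_map A x x, Measure.map_map (measurable_update_const i t)
    (measurable_piecewise_left A x)]
  simp only [comp_def, update_piecewise_of_notMem _ _ _ hi]

lemma partialVolume_singleton (i : ι) (x : ι → ℝ) :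
    partialVolume {i} x = (volume : Measure ℝ).map (update x i) := by
  have heval : (partialVolume {i} x).map (eval i) = volume := by
    rw [partialVolume, Measure.pi_map_eval, prod_eq_one, one_smul, if_pos (mem_singleton_self i)]
    exact fun j hj ↦ by simp [ne_of_mem_erase hj]
  rw [partialVolume_eq_map {i} x x, ← heval,
    Measure.map_map (measurable_update x) (measurable_pi_apply i)]
  simp only [piecewise_singleton, comp_def, eval]

lemma ae_partialVolume (A : Finset ι) (x : ι → ℝ) :
    ∀ᵐ y ∂partialVolume A x, ∀ i ∉ A, y i = x i := by
  rw [partialVolume_eq_map A x x, ae_map_iff (measurable_piecewise_left A x).aemeasurable]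
  · exact Filter.Eventually.of_forall fun z i hi ↦ by simp [hi]
  · simp only [Set.ofPred_forall]
    exact MeasurableSet.iInter fun i ↦ MeasurableSet.iInter fun _ ↦
      measurableSet_eq_fun (measurable_pi_apply i) measurable_const

lemma integral_partialVolume (hF : Measurable F) (A : Finset ι) (x x' : ι → ℝ) :
    ∫ y, F y ∂partialVolume A x = ∫ z, F (A.piecewise z x) ∂partialVolume A x' := by
  rw [partialVolume_eq_map A x x', integral_map (measurable_piecewise_left A x).aemeasurable
    hF.aestronglyMeasurable]

lemma measurable_integral_partialVolume (hF : Measurable F) (A : Finset ι) :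
    Measurable fun x ↦ ∫ y, F y ∂partialVolume A x := by
  simp only [fun x ↦ integral_partialVolume hF A x 0]
  exact (hF.comp (measurable_piecewise A)).stronglyMeasurable.integral_prod_right'.measurable

lemma integral_partialVolume_update (hF : Measurable F) {i : ι} (hi : i ∉ A) (x : ι → ℝ) (t : ℝ) :
    ∫ y, F y ∂partialVolume A (update x i t) = ∫ y, F (update y i t) ∂partialVolume A x := by
  rw [partialVolume_update hi, integral_map (measurable_update_const i t).aemeasurable
    hF.aestronglyMeasurable]

lemma integral_partialVolume_singleton (hF : Measurable F) (i : ι) (x : ι → ℝ) :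
    ∫ y, F y ∂partialVolume {i} x = ∫ t, F (update x i t) := by
  rw [partialVolume_singleton, integral_map (measurable_update x).aemeasurable
    hF.aestronglyMeasurable]

lemma integrable_partialVolume_singleton_iff (hF : Measurable F) (i : ι) (x : ι → ℝ) :
    Integrable F (partialVolume {i} x) ↔ Integrable fun t ↦ F (update x i t) := by
  rw [partialVolume_singleton, integrable_map_measure hF.aestronglyMeasurable
    (measurable_update x).aemeasurable, comp_def]

lemma integrable_piecewise_prod (hFm : Measurable F) (hAB : Disjoint A B) {x : ι → ℝ}
    (hF : Integrable F (partialVolume (A ∪ B) x)) :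
    Integrable (fun p : (ι → ℝ) × (ι → ℝ) ↦ F (B.piecewise p.2 p.1))
      ((partialVolume A x).prod (partialVolume B x)) := by
  rw [partialVolume_union hAB x x] at hF
  exact (integrable_map_measure hFm.aestronglyMeasurable
    (measurable_piecewise B).aemeasurable).1 hF

lemma integral_partialVolume_union (hFm : Measurable F) (hAB : Disjoint A B) {x : ι → ℝ}
    (hF : Integrable F (partialVolume (A ∪ B) x)) :
    ∫ y, F y ∂partialVolume (A ∪ B) x = ∫ y, ∫ z, F z ∂partialVolume B y ∂partialVolume A x := by
  rw [partialVolume_union hAB x x, integral_map (measurable_piecewise B).aemeasurable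
    hFm.aestronglyMeasurable, integral_prod _ (integrable_piecewise_prod hFm hAB hF)]
  simp only [fun y ↦ integral_partialVolume hFm B y x]

lemma integrable_integral_partialVolume (hFm : Measurable F) (hAB : Disjoint A B) {x : ι → ℝ}
    (hF : Integrable F (partialVolume (A ∪ B) x)) :
    Integrable (fun y ↦ ∫ z, F z ∂partialVolume B y) (partialVolume A x) := by
  simp only [fun y ↦ integral_partialVolume hFm B y x]
  exact (integrable_piecewise_prod hFm hAB hF).integral_prod_left

lemma ae_integrable_partialVolume (hFm : Measurable F) (hAB : Disjoint A B) {x : ι → ℝ}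
    (hF : Integrable F (partialVolume (A ∪ B) x)) :
    ∀ᵐ y ∂partialVolume A x, Integrable F (partialVolume B y) := by
  filter_upwards [(integrable_piecewise_prod hFm hAB hF).prod_right_ae] with y hy
  rwa [partialVolume_eq_map B y x, integrable_map_measure hFm.aestronglyMeasurable
    (measurable_piecewise_left B y).aemeasurable]

end PartialVolume

/-- The hypotheses on the perturbation `ψb` of the quadratic single-site potential: it is twice
differentiable and its first two derivatives are bounded by `K`. -/
structure HasBoundedDerivs (K : ℝ) (ψb : ℝ → ℝ) : Prop where
  differentiable : Differentiable ℝ ψb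
  differentiable_deriv : Differentiable ℝ (deriv ψb)
  abs_deriv_le : ∀ z, |deriv ψb z| ≤ K
  abs_deriv_deriv_le : ∀ z, |deriv (deriv ψb) z| ≤ K

namespace HasBoundedDerivs

variable {K : ℝ} {ψb : ℝ → ℝ}

lemma nonneg (h : HasBoundedDerivs K ψb) : 0 ≤ K := (abs_nonneg _).trans (h.abs_deriv_le 0)

lemma abs_le (h : HasBoundedDerivs K ψb) (z : ℝ) : |ψb z| ≤ |ψb 0| + K * |z| := by
  have hlip : |ψb z - ψb 0| ≤ K * |z - 0| :=
    convex_univ.norm_image_sub_le_of_norm_deriv_le (fun y _ ↦ h.differentiable y)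
      (fun y _ ↦ h.abs_deriv_le y) (Set.mem_univ 0) (Set.mem_univ z)
  rw [sub_zero] at hlip
  linarith [abs_sub_abs_le_abs_sub (ψb z) (ψb 0)]

end HasBoundedDerivs

/-- A finite system of unbounded spins, with a perturbation `ψb` of the quadratic single-site
potential whose first two derivatives are bounded, interaction matrix `M` and external field `s`. -/
structure Model (ι : Type*) [Fintype ι] (K δ : ℝ) where
  ψb : ℝ → ℝ
  M : Matrix ι ι ℝ
  s : ι → ℝ
  δ_pos : 0 < δ
  hasBoundedDerivs : HasBoundedDerivs K ψb
  isDominant : IsDominant δ M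

namespace Model

section Energy

variable {ι : Type*} [Fintype ι] {K δ : ℝ} (m : Model ι K δ)

include m in
lemma K_nonneg : 0 ≤ K := m.hasBoundedDerivs.nonneg

lemma sum_abs_row_le (i : ι) : ∑ j, |m.M i j| ≤ 2 :=
  (m.isDominant.row i).trans (by linarith [m.δ_pos])

/-- The Hamiltonian, with the quadratic single-site potentials absorbed into the interaction. -/
def energy (x : ι → ℝ) : ℝ :=
  ∑ i, (m.ψb (x i) + m.s i * x i) + 1 / 2 * ∑ i, ∑ j, m.M i j * (x i * x j)

/-- The partial derivative of the energy in the coordinate `i`. -/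
def energyDeriv (i : ι) (x : ι → ℝ) : ℝ := deriv m.ψb (x i) + m.s i + ∑ j, m.M i j * x j

/-- The Boltzmann weight. -/
def weight (x : ι → ℝ) : ℝ := Real.exp (-m.energy x)

lemma measurable_energy : Measurable m.energy := by
  have := m.hasBoundedDerivs.differentiable.continuous
  unfold energy
  fun_prop

lemma weight_pos (x : ι → ℝ) : 0 < m.weight x := Real.exp_pos _

lemma measurable_weight : Measurable m.weight := m.measurable_energy.neg.exp

lemma isTame_deriv_ψb (i : ι) : IsTame fun x : ι → ℝ ↦ deriv m.ψb (x i) :=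
  IsBoundedMeasurable.isTame ⟨(measurable_deriv m.ψb).comp (measurable_pi_apply i), K,
    fun x ↦ m.hasBoundedDerivs.abs_deriv_le (x i)⟩

lemma isTame_energyDeriv (i : ι) : IsTame (m.energyDeriv i) :=
  ((m.isTame_deriv_ψb i).add (.const _)).add (.sum _ fun j _ ↦ (IsTame.coord j).const_mul _)

/-- The exponent of a Gaussian bound for `exp (c * ∑ i, |x i|)` times the Boltzmann weight. -/
def envelope (c : ℝ) (x : ι → ℝ) : ℝ :=
  ∑ i, ((c + |m.s i| + K) * |x i| - δ / 2 * x i ^ 2)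

lemma mul_sum_abs_sub_energy_le (c : ℝ) (x : ι → ℝ) :
    c * ∑ i, |x i| - m.energy x ≤ Fintype.card ι * |m.ψb 0| + m.envelope c x := by
  have hsite (i : ι) : -(m.ψb (x i) + m.s i * x i) ≤ |m.ψb 0| + (|m.s i| + K) * |x i| := by
    have hfield := neg_abs_le (m.s i * x i)
    rw [abs_mul] at hfield
    linarith [neg_abs_le (m.ψb (x i)), m.hasBoundedDerivs.abs_le (x i)]
  have hsum := sum_le_sum fun i (_ : i ∈ univ) ↦ hsite i
  have henv : m.envelope c x
      = c * ∑ i, |x i| + ∑ i, (|m.s i| + K) * |x i| - δ / 2 * ∑ i, x i ^ 2 := by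
    simp only [envelope, mul_sum, ← sum_add_distrib, ← sum_sub_distrib]
    exact sum_congr rfl fun i _ ↦ by ring
  simp only [sum_neg_distrib, sum_add_distrib, sum_const, card_univ, nsmul_eq_mul] at hsum
  rw [energy, henv]
  simp only [sum_add_distrib]
  linarith [m.isDominant.mul_sum_sq_le x]

lemma exists_abs_mul_weight_le {F : (ι → ℝ) → ℝ} (hF : IsTame F) :
    ∃ C ≥ 0, ∃ c ≥ 0, ∀ x, |F x * m.weight x| ≤ C * Real.exp (m.envelope c x) := by
  obtain ⟨C, hC, c, hc, hFC⟩ := hF.growth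
  refine ⟨C * Real.exp (Fintype.card ι * |m.ψb 0|), by positivity, c, hc, fun x ↦ ?_⟩
  calc |F x * m.weight x| = |F x| * m.weight x := by rw [abs_mul, abs_of_pos (m.weight_pos x)]
    _ ≤ C * Real.exp (c * ∑ i, |x i|) * m.weight x := by
        gcongr
        · exact (m.weight_pos x).le
        · exact hFC x
    _ = C * Real.exp (c * ∑ i, |x i| - m.energy x) := by
        rw [weight, mul_assoc, ← Real.exp_add, sub_eq_add_neg]
    _ ≤ C * Real.exp (Fintype.card ι * |m.ψb 0| + m.envelope c x) := by
        gcongr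
        exact m.mul_sum_abs_sub_energy_le c x
    _ = C * Real.exp (Fintype.card ι * |m.ψb 0|) * Real.exp (m.envelope c x) := by
        rw [Real.exp_add, mul_assoc]

variable [DecidableEq ι]

lemma integrable_exp_envelope (c : ℝ) (A : Finset ι) (x : ι → ℝ) :
    Integrable (fun y ↦ Real.exp (m.envelope c y)) (partialVolume A x) := by
  simp only [envelope, Real.exp_sum]
  have hsite (i : ι) : Integrable (fun t ↦ Real.exp ((c + |m.s i| + K) * |t| - δ / 2 * t ^ 2))
      (if i ∈ A then volume else Measure.dirac (x i)) := by
    split_ifs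
    · exact integrable_exp_mul_abs_sub_mul_sq (half_pos m.δ_pos) _
    · exact integrable_dirac (by simp)
  exact Integrable.fintype_prod hsite

lemma integrable_mul_weight {F : (ι → ℝ) → ℝ} (hF : IsTame F) (A : Finset ι) (x : ι → ℝ) :
    Integrable (fun y ↦ F y * m.weight y) (partialVolume A x) := by
  obtain ⟨C, -, c, -, hC⟩ := m.exists_abs_mul_weight_le hF
  exact ((m.integrable_exp_envelope c A x).const_mul C).mono'
    (hF.measurable.mul m.measurable_weight).aestronglyMeasurable
    (Filter.Eventually.of_forall hC)

lemma integrable_weight (A : Finset ι) (x : ι → ℝ) :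
    Integrable m.weight (partialVolume A x) := by
  simpa only [one_mul] using m.integrable_mul_weight (.const 1) A x

lemma hasDerivAt_energy (x : ι → ℝ) (i : ι) (t : ℝ) :
    HasDerivAt (fun t ↦ m.energy (update x i t)) (m.energyDeriv i (update x i t)) t := by
  have hcoord (j : ι) : HasDerivAt (fun t ↦ update x i t j) ((Pi.single i 1 : ι → ℝ) j) t :=
    hasDerivAt_pi.1 (hasDerivAt_update x i t) j
  have hsite (j : ι) := ((m.hasBoundedDerivs.differentiable _).hasDerivAt.comp t (hcoord j)).add
    ((hcoord j).const_mul (m.s j))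
  have hpair (j k : ι) := ((hcoord j).mul (hcoord k)).const_mul (m.M j k)
  have hderiv := (HasDerivAt.fun_sum (u := univ) fun j _ ↦ hsite j).add
    ((HasDerivAt.fun_sum (u := univ) fun j _ ↦
      HasDerivAt.fun_sum (u := univ) fun k _ ↦ hpair j k).const_mul (1 / 2 : ℝ))
  refine hderiv.congr_deriv ?_
  simp only [energyDeriv, Pi.single_apply, mul_add, sum_add_distrib, mul_ite, ite_mul, mul_one,
    one_mul, mul_zero, zero_mul, sum_ite_eq', mem_univ, if_true, sum_ite_irrel, sum_const_zero]
  simp only [m.isDominant.symm _ i]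
  ring

lemma hasDerivAt_energyDeriv (x : ι → ℝ) (k i : ι) (t : ℝ) :
    HasDerivAt (fun t ↦ m.energyDeriv k (update x i t))
      ((if k = i then deriv (deriv m.ψb) (update x i t k) else 0) + m.M k i) t := by
  have hcoord (j : ι) : HasDerivAt (fun t ↦ update x i t j) ((Pi.single i 1 : ι → ℝ) j) t :=
    hasDerivAt_pi.1 (hasDerivAt_update x i t) j
  have hderiv := (((m.hasBoundedDerivs.differentiable_deriv _).hasDerivAt.comp t
    (hcoord k)).add_const (m.s k)).add
      (HasDerivAt.fun_sum (u := univ) fun j _ ↦ (hcoord j).const_mul (m.M k j))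
  refine hderiv.congr_deriv ?_
  simp [Pi.single_apply]

lemma hasDerivAt_weight (x : ι → ℝ) (i : ι) (t : ℝ) :
    HasDerivAt (fun t ↦ m.weight (update x i t))
      (-(m.energyDeriv i (update x i t) * m.weight (update x i t))) t := by
  refine (m.hasDerivAt_energy x i t).neg.exp.congr_deriv ?_
  rw [weight, Pi.neg_apply, mul_neg, mul_comm]

end Energy

section Gibbs

variable {ι : Type*} [Fintype ι] [DecidableEq ι] {K δ : ℝ} (m : Model ι K δ)

/-- The Gibbs measure in the coordinates of `A`, the other coordinates being frozen at `x`. -/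
def gibbs (A : Finset ι) (x : ι → ℝ) : Measure (ι → ℝ) :=
  (partialVolume A x).tilted fun y ↦ -m.energy y

/-- The normalizing constant of `gibbs`. -/
def partitionFunction (A : Finset ι) (x : ι → ℝ) : ℝ := ∫ y, m.weight y ∂partialVolume A x

/-- The expectation of `g` under `gibbs`, that is, its conditional expectation given the coordinates
outside `A`. -/
def condMean (A : Finset ι) (g : (ι → ℝ) → ℝ) (x : ι → ℝ) : ℝ := ∫ y, g y ∂m.gibbs A x

instance isProbabilityMeasure_gibbs (A : Finset ι) (x : ι → ℝ) :
    IsProbabilityMeasure (m.gibbs A x) :=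
  isProbabilityMeasure_tilted (m.integrable_weight A x)

variable {A B : Finset ι} {f g u : (ι → ℝ) → ℝ}

lemma partitionFunction_pos (A : Finset ι) (x : ι → ℝ) : 0 < m.partitionFunction A x :=
  integral_exp_pos (m.integrable_weight A x)

lemma condMean_eq_div (A : Finset ι) (g : (ι → ℝ) → ℝ) (x : ι → ℝ) :
    m.condMean A g x = (∫ y, g y * m.weight y ∂partialVolume A x) / m.partitionFunction A x := by
  rw [condMean, gibbs, integral_tilted, ← integral_div]
  simp only [smul_eq_mul, div_mul_eq_mul_div, mul_comm (g _), partitionFunction, weight]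

lemma integral_mul_weight (A : Finset ι) (g : (ι → ℝ) → ℝ) (x : ι → ℝ) :
    ∫ y, g y * m.weight y ∂partialVolume A x = m.condMean A g x * m.partitionFunction A x := by
  rw [condMean_eq_div, div_mul_cancel₀ _ (m.partitionFunction_pos A x).ne']

lemma integrable_gibbs (hg : IsTame g) (A : Finset ι) (x : ι → ℝ) :
    Integrable g (m.gibbs A x) := by
  rw [gibbs, integrable_tilted_iff (m.integrable_weight A x)]
  simpa only [smul_eq_mul, mul_comm, weight] using m.integrable_mul_weight hg A x

lemma memLp_gibbs (hg : IsTame g) (A : Finset ι) (x : ι → ℝ) : MemLp g 2 (m.gibbs A x) := by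
  rw [memLp_two_iff_integrable_sq hg.measurable.aestronglyMeasurable]
  simpa only [pow_two] using m.integrable_gibbs (hg.mul hg) A x

lemma ae_gibbs (A : Finset ι) (x : ι → ℝ) : ∀ᵐ y ∂m.gibbs A x, ∀ i ∉ A, y i = x i :=
  (tilted_absolutelyContinuous _ _).ae_le (ae_partialVolume A x)

lemma ae_eq_of_dependsOn (hu : DependsOn u (Aᶜ : Set ι)) (x : ι → ℝ) :
    u =ᵐ[m.gibbs A x] fun _ ↦ u x := by
  filter_upwards [m.ae_gibbs A x] with y hy
  exact hu fun i hi ↦ hy i (by simpa using hi)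

lemma dependsOn_gibbs (A : Finset ι) : DependsOn (m.gibbs A) (Aᶜ : Set ι) := fun x x' h ↦ by
  rw [gibbs, gibbs, partialVolume_congr fun i hi ↦ h i (by simpa using hi)]

lemma dependsOn_condMean (A : Finset ι) (g : (ι → ℝ) → ℝ) :
    DependsOn (m.condMean A g) (Aᶜ : Set ι) := fun x x' h ↦ by
  rw [condMean, condMean, m.dependsOn_gibbs A h]

lemma measurable_condMean (hg : Measurable g) (A : Finset ι) : Measurable (m.condMean A g) := by
  simp only [funext (m.condMean_eq_div A g), partitionFunction]
  exact (measurable_integral_partialVolume (hg.mul m.measurable_weight) A).div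
    (measurable_integral_partialVolume m.measurable_weight A)

lemma abs_condMean_le {C : ℝ} (hg : ∀ y, |g y| ≤ C) (A : Finset ι) (x : ι → ℝ) :
    |m.condMean A g x| ≤ C := by
  have hle := norm_integral_le_of_norm_le_const (μ := m.gibbs A x)
    (Filter.Eventually.of_forall fun y ↦ (Real.norm_eq_abs (g y)).trans_le (hg y))
  rwa [probReal_univ, mul_one, Real.norm_eq_abs] at hle

lemma isBoundedMeasurable_condMean (hg : IsBoundedMeasurable g) (A : Finset ι) :
    IsBoundedMeasurable (m.condMean A g) := by
  obtain ⟨C, hC⟩ := hg.bounded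
  exact ⟨m.measurable_condMean hg.measurable A, C, m.abs_condMean_le hC A⟩

lemma condMean_add (hf : IsTame f) (hg : IsTame g) (A : Finset ι) (x : ι → ℝ) :
    m.condMean A (fun y ↦ f y + g y) x = m.condMean A f x + m.condMean A g x :=
  integral_add (m.integrable_gibbs hf A x) (m.integrable_gibbs hg A x)

lemma condMean_mono (hf : IsTame f) (hg : IsTame g) (hfg : ∀ y, f y ≤ g y) (A : Finset ι)
    (x : ι → ℝ) : m.condMean A f x ≤ m.condMean A g x :=
  integral_mono (m.integrable_gibbs hf A x) (m.integrable_gibbs hg A x) hfg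

lemma condMean_mul_of_dependsOn (hu : DependsOn u (Aᶜ : Set ι)) (g : (ι → ℝ) → ℝ) :
    m.condMean A (fun y ↦ u y * g y) = fun x ↦ u x * m.condMean A g x := by
  ext x
  rw [condMean, condMean, ← integral_const_mul]
  refine integral_congr_ae ?_
  filter_upwards [m.ae_eq_of_dependsOn hu x] with y hy
  rw [hy]

lemma condMean_of_dependsOn (hu : DependsOn u (Aᶜ : Set ι)) (x : ι → ℝ) :
    m.condMean A u x = u x := by
  rw [condMean, integral_congr_ae (m.ae_eq_of_dependsOn hu x), integral_const, probReal_univ,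
    one_smul]

lemma condMean_condMean (hBA : B ⊆ A) (hg : IsBoundedMeasurable g) :
    m.condMean A (m.condMean B g) = m.condMean A g := by
  ext x
  have hdisj : Disjoint (A \ B) B := sdiff_disjoint
  have hint (f : (ι → ℝ) → ℝ) (hf : IsBoundedMeasurable f) :
      ∫ y, f y * m.weight y ∂partialVolume A x
        = ∫ y, ∫ z, f z * m.weight z ∂partialVolume B y ∂partialVolume (A \ B) x := by
    have hunion := integral_partialVolume_union (hf.measurable.mul m.measurable_weight) hdisj
      (x := x) (by rw [sdiff_union_of_subset hBA]; exact m.integrable_mul_weight hf.isTame A x)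
    rwa [sdiff_union_of_subset hBA] at hunion
  rw [condMean_eq_div, condMean_eq_div, hint _ (m.isBoundedMeasurable_condMean hg B), hint g hg]
  simp only [integral_mul_weight]
  rw [funext (m.condMean_of_dependsOn (m.dependsOn_condMean B g))]

lemma condMean_mul_condMean (hBA : B ⊆ A) (hu : DependsOn u (Bᶜ : Set ι))
    (hub : IsBoundedMeasurable u) (hg : IsBoundedMeasurable g) :
    m.condMean A (fun y ↦ u y * m.condMean B g y) = m.condMean A fun y ↦ u y * g y := by
  rw [← m.condMean_mul_of_dependsOn hu, m.condMean_condMean hBA (hub.mul hg)]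

lemma variance_gibbs_eq_sub (hg : IsTame g) (A : Finset ι) (x : ι → ℝ) :
    Var[g; m.gibbs A x] = m.condMean A (fun y ↦ g y ^ 2) x - m.condMean A g x ^ 2 :=
  variance_eq_sub (m.memLp_gibbs hg A x)

lemma isBoundedMeasurable_variance_gibbs (hg : IsBoundedMeasurable g) (A : Finset ι) :
    IsBoundedMeasurable fun x ↦ Var[g; m.gibbs A x] := by
  simp only [m.variance_gibbs_eq_sub hg.isTame]
  exact (m.isBoundedMeasurable_condMean hg.sq A).sub (m.isBoundedMeasurable_condMean hg A).sq

lemma variance_gibbs_eq_add (hBA : B ⊆ A) (hg : IsBoundedMeasurable g) (x : ι → ℝ) :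
    Var[g; m.gibbs A x] = m.condMean A (fun y ↦ Var[g; m.gibbs B y]) x
      + Var[m.condMean B g; m.gibbs A x] := by
  have hmean := m.isBoundedMeasurable_condMean hg B
  have hcond : m.condMean A (fun y ↦ g y ^ 2) x
      = m.condMean A (fun y ↦ Var[g; m.gibbs B y]) x
        + m.condMean A (fun y ↦ m.condMean B g y ^ 2) x := by
    rw [← m.condMean_add (m.isBoundedMeasurable_variance_gibbs hg B).isTame hmean.sq.isTame,
      ← m.condMean_condMean hBA hg.sq]
    simp only [m.variance_gibbs_eq_sub hg.isTame, sub_add_cancel]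
  rw [m.variance_gibbs_eq_sub hg.isTame, m.variance_gibbs_eq_sub hmean.isTame, hcond,
    m.condMean_condMean hBA hg]
  ring

lemma covariance_condMean (hBA : B ⊆ A) (hu : DependsOn u (Bᶜ : Set ι))
    (hub : IsBoundedMeasurable u) (hg : IsBoundedMeasurable g) (x : ι → ℝ) :
    cov[u, m.condMean B g; m.gibbs A x] = cov[u, g; m.gibbs A x] := by
  have hmean := m.isBoundedMeasurable_condMean hg B
  have hprod := congrFun (m.condMean_mul_condMean hBA hu hub hg) x
  have hcond := congrFun (m.condMean_condMean hBA hg) x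
  rw [covariance_eq_sub (m.memLp_gibbs hub.isTame A x) (m.memLp_gibbs hmean.isTame A x),
    covariance_eq_sub (m.memLp_gibbs hub.isTame A x) (m.memLp_gibbs hg.isTame A x)]
  simp only [condMean, Pi.mul_apply] at hprod hcond ⊢
  rw [hprod, hcond]

end Gibbs

end Model

section SpinVarBound

variable {K δ : ℝ}

/-- A bound, in terms of the parameters of the model, on the variance of a single spin under a Gibbs
measure with an arbitrary set of frozen spins. -/
def spinVarBound (K δ : ℝ) : ℝ := 2 / δ + (K / δ) ^ 2

lemma spinVarBound_nonneg (K : ℝ) (hδ : 0 < δ) : 0 ≤ spinVarBound K δ := by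
  unfold spinVarBound
  positivity

lemma le_spinVarBound_of_mul_le {V : ℝ} (hδ : 0 < δ) (hV : 0 ≤ V) (h : δ * V ≤ 1 + √V * K) :
    V ≤ spinVarBound K δ := by
  have hamgm : √V * K ≤ δ * V / 2 + δ / 2 * (K / δ) ^ 2 := by
    have hsq : δ * V / 2 + δ / 2 * (K / δ) ^ 2 - √V * K = δ / 2 * (√V - K / δ) ^ 2 := by
      nth_rewrite 1 [← Real.sq_sqrt hV]
      field_simp
      ring
    have : 0 ≤ δ / 2 * (√V - K / δ) ^ 2 := by positivity
    linarith
  refine le_of_mul_le_mul_left ?_ hδ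
  have hbound : δ * spinVarBound K δ = 2 + δ * (K / δ) ^ 2 := by
    rw [spinVarBound, mul_add, mul_div_cancel₀ _ hδ.ne']
  linarith

end SpinVarBound

namespace Model

section IntegrationByParts

variable {ι : Type*} [Fintype ι] [DecidableEq ι] {K δ : ℝ} (m : Model ι K δ) {A : Finset ι}
  {i : ι} {F F' : (ι → ℝ) → ℝ}

lemma condMean_mul_energyDeriv (hi : i ∈ A) (hF : IsTame F) (hF' : IsTame F')
    (hd : ∀ x t, HasDerivAt (fun t ↦ F (update x i t)) (F' (update x i t)) t) (x : ι → ℝ) :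
    m.condMean A (fun y ↦ F y * m.energyDeriv i y) x = m.condMean A F' x := by
  have hprod := hF.mul (m.isTame_energyDeriv i)
  have hdiff := hF'.sub hprod
  have hunion : A.erase i ∪ {i} = A := by rw [union_comm]; exact insert_erase hi
  have hdisj : Disjoint (A.erase i) {i} := by simp
  have hdiffm := hdiff.measurable.mul m.measurable_weight
  have hFm := hF.measurable.mul m.measurable_weight
  have hdiffi := m.integrable_mul_weight hdiff A x
  have hFi := m.integrable_mul_weight hF A x
  symm
  rw [← sub_eq_zero, condMean, condMean, ← integral_sub (m.integrable_gibbs hF' A x)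
    (m.integrable_gibbs hprod A x), ← condMean, condMean_eq_div, div_eq_zero_iff]
  left
  rw [← hunion] at hdiffi hFi ⊢
  refine (integral_partialVolume_union hdiffm hdisj hdiffi).trans (integral_eq_zero_of_ae ?_)
  filter_upwards [ae_integrable_partialVolume hdiffm hdisj hdiffi,
    ae_integrable_partialVolume hFm hdisj hFi] with y hdiffy hFy
  rw [integrable_partialVolume_singleton_iff hdiffm] at hdiffy
  rw [integrable_partialVolume_singleton_iff hFm] at hFy
  rw [integral_partialVolume_singleton hdiffm]
  refine integral_eq_zero_of_hasDerivAt_of_integrable (fun t ↦ ?_) hdiffy hFy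
  refine ((hd y t).mul (m.hasDerivAt_weight y i t)).congr_deriv ?_
  simp only [Pi.mul_apply]
  ring

lemma condMean_energyDeriv (hi : i ∈ A) (x : ι → ℝ) : m.condMean A (m.energyDeriv i) x = 0 := by
  have hparts := m.condMean_mul_energyDeriv hi (.const 1) (.const 0)
    (fun _ t ↦ hasDerivAt_const t (1 : ℝ)) x
  simpa only [one_mul, condMean, integral_zero] using hparts

lemma covariance_energyDeriv (hi : i ∈ A) (hF : IsTame F) (hF' : IsTame F')
    (hd : ∀ x t, HasDerivAt (fun t ↦ F (update x i t)) (F' (update x i t)) t) (x : ι → ℝ) :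
    cov[F, m.energyDeriv i; m.gibbs A x] = m.condMean A F' x := by
  have hmean : ∫ y, m.energyDeriv i y ∂m.gibbs A x = 0 := m.condMean_energyDeriv hi x
  rw [covariance_eq_sub (m.memLp_gibbs hF A x) (m.memLp_gibbs (m.isTame_energyDeriv i) A x), hmean,
    mul_zero, sub_zero]
  exact m.condMean_mul_energyDeriv hi hF hF' hd x

lemma covariance_coord_energyDeriv (hi : i ∈ A) (j : ι) (x : ι → ℝ) :
    cov[fun y ↦ y j, m.energyDeriv i; m.gibbs A x] = if j = i then 1 else 0 := by
  have hcoord (y : ι → ℝ) (t : ℝ) :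
      HasDerivAt (fun t ↦ update y i t j) (if j = i then 1 else 0) t := by
    simpa only [Pi.single_apply] using hasDerivAt_pi.1 (hasDerivAt_update y i t) j
  rw [m.covariance_energyDeriv hi (.coord j) (.const _) hcoord, condMean, integral_const,
    probReal_univ, one_smul]

end IntegrationByParts

section SpinVariance

variable {ι : Type*} [Fintype ι] [DecidableEq ι] {K δ : ℝ} (m : Model ι K δ) {A : Finset ι}
  {i k : ι} {F : (ι → ℝ) → ℝ}

lemma memLp_const_mul_coord (c : ℝ) (j : ι) (A : Finset ι) (x : ι → ℝ) :
    MemLp (fun y ↦ c * y j) 2 (m.gibbs A x) :=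
  m.memLp_gibbs ((IsTame.coord j).const_mul c) A x

lemma covariance_energyDeriv_eq_add (hF : IsTame F) (A : Finset ι) (i : ι) (x : ι → ℝ) :
    cov[F, m.energyDeriv i; m.gibbs A x] = cov[F, fun y ↦ deriv m.ψb (y i); m.gibbs A x]
      + ∑ j, m.M i j * cov[F, fun y ↦ y j; m.gibbs A x] := by
  have hψ := m.isTame_deriv_ψb i
  have hlin := fun j ↦ m.memLp_const_mul_coord (m.M i j) j A x
  calc cov[F, m.energyDeriv i; m.gibbs A x]
      = cov[F, fun y ↦ deriv m.ψb (y i) + m.s i; m.gibbs A x]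
        + cov[F, fun y ↦ ∑ j, m.M i j * y j; m.gibbs A x] :=
        covariance_add_right (m.memLp_gibbs hF A x) (m.memLp_gibbs (hψ.add (.const _)) A x)
          (memLp_finsetSum univ fun j _ ↦ hlin j)
    _ = _ := by
        rw [covariance_add_const_right (m.integrable_gibbs hψ A x),
          covariance_fun_sum_right hlin (m.memLp_gibbs hF A x)]
        simp only [covariance_const_mul_right]

lemma sqrt_variance_deriv_ψb_le (A : Finset ι) (i : ι) (x : ι → ℝ) :
    √Var[fun y ↦ deriv m.ψb (y i); m.gibbs A x] ≤ K := by
  have hle := variance_le_sq_of_bounded (μ := m.gibbs A x) (a := -K) (b := K)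
    (Filter.Eventually.of_forall fun y ↦ abs_le.1 (m.hasBoundedDerivs.abs_deriv_le (y i)))
    (m.isTame_deriv_ψb i).measurable.aemeasurable
  refine Real.sqrt_le_iff.2 ⟨m.K_nonneg, hle.trans_eq ?_⟩
  ring

lemma abs_sum_mul_covariance_coord_le (hk : k ∈ A) (j : ι) (x : ι → ℝ) :
    |∑ l, m.M k l * cov[fun y ↦ y j, fun y ↦ y l; m.gibbs A x]|
      ≤ 1 + √Var[fun y ↦ y j; m.gibbs A x] * K := by
  have hident := m.covariance_coord_energyDeriv hk j x
  rw [m.covariance_energyDeriv_eq_add (.coord j)] at hident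
  rw [eq_sub_of_add_eq' hident]
  refine (abs_sub _ _).trans (add_le_add (by split_ifs <;> simp) ?_)
  calc |cov[fun y ↦ y j, fun y ↦ deriv m.ψb (y k); m.gibbs A x]|
      ≤ √Var[fun y ↦ y j; m.gibbs A x] * √Var[fun y ↦ deriv m.ψb (y k); m.gibbs A x] :=
        abs_covariance_le (m.memLp_gibbs (.coord j) A x) (m.memLp_gibbs (m.isTame_deriv_ψb k) A x)
    _ ≤ √Var[fun y ↦ y j; m.gibbs A x] * K := by
        gcongr
        exact m.sqrt_variance_deriv_ψb_le A k x

lemma variance_coord_of_notMem (hk : k ∉ A) (x : ι → ℝ) : Var[fun y ↦ y k; m.gibbs A x] = 0 :=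
  variance_eq_zero_of_ae_eq_const ((m.ae_gibbs A x).mono fun _ hy ↦ hy k hk)

lemma variance_coord_le (A : Finset ι) (j : ι) (x : ι → ℝ) :
    Var[fun y ↦ y j; m.gibbs A x] ≤ spinVarBound K δ := by
  have hcov (k : ι) : |cov[fun y ↦ y j, fun y ↦ y k; m.gibbs A x]| ≤ 0 ∨
      |∑ l, m.M k l * cov[fun y ↦ y j, fun y ↦ y l; m.gibbs A x]|
        ≤ 1 + √Var[fun y ↦ y j; m.gibbs A x] * K := by
    by_cases hk : k ∈ A
    · exact Or.inr (m.abs_sum_mul_covariance_coord_le hk j x)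
    · have hle := abs_covariance_le (m.memLp_gibbs (.coord j) A x) (m.memLp_gibbs (.coord k) A x)
      rw [m.variance_coord_of_notMem hk, Real.sqrt_zero, mul_zero] at hle
      exact Or.inl hle
  have hK := m.K_nonneg
  have hmax := m.isDominant.abs_le_of_abs_sum_mul_le m.δ_pos le_rfl (by positivity) hcov j
  rw [covariance_self (measurable_pi_apply j).aemeasurable, abs_of_nonneg (variance_nonneg _ _),
    zero_add, le_div_iff₀' m.δ_pos] at hmax
  exact le_spinVarBound_of_mul_le m.δ_pos (variance_nonneg _ _) hmax

lemma sqrt_variance_energyDeriv_le (hi : i ∉ A) (x : ι → ℝ) :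
    √Var[m.energyDeriv i; m.gibbs A x] ≤ 2 * √(spinVarBound K δ) := by
  have hlin (j : ι) := m.memLp_const_mul_coord (m.M i j) j A x
  have hfrozen : m.energyDeriv i =ᵐ[m.gibbs A x]
      fun y ↦ (deriv m.ψb (x i) + m.s i) + ∑ j, m.M i j * y j := by
    filter_upwards [m.ae_gibbs A x] with y hy
    rw [energyDeriv, hy i hi]
  rw [variance_congr hfrozen,
    variance_const_add (memLp_finsetSum univ fun j _ ↦ hlin j).aestronglyMeasurable]
  calc √Var[fun y ↦ ∑ j, m.M i j * y j; m.gibbs A x]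
      ≤ ∑ j, √Var[fun y ↦ m.M i j * y j; m.gibbs A x] := sqrt_variance_sum_le univ fun j _ ↦ hlin j
    _ ≤ ∑ j, |m.M i j| * √(spinVarBound K δ) := by
        refine sum_le_sum fun j _ ↦ ?_
        rw [variance_const_mul, Real.sqrt_mul (sq_nonneg _), Real.sqrt_sq_eq_abs]
        gcongr
        exact m.variance_coord_le A j x
    _ ≤ 2 * √(spinVarBound K δ) := by
        rw [← sum_mul]
        gcongr
        exact m.sum_abs_row_le i

end SpinVariance

section CramerRao

variable {ι : Type*} [Fintype ι] [DecidableEq ι] {K δ : ℝ} (m : Model ι K δ)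

lemma covariance_energyDeriv_energyDeriv_le {A : Finset ι} {j : ι} (hj : j ∈ A) (i : ι)
    (x : ι → ℝ) :
    cov[m.energyDeriv i, m.energyDeriv j; m.gibbs A x] ≤ (if i = j then K else 0) + |m.M i j| := by
  have hsecond : IsTame fun y : ι → ℝ ↦
      (if i = j then deriv (deriv m.ψb) (y i) else 0) + m.M i j := by
    refine .add ?_ (.const _)
    split_ifs
    · exact IsBoundedMeasurable.isTame ⟨(measurable_deriv _).comp (measurable_pi_apply i), K,
        fun y ↦ m.hasBoundedDerivs.abs_deriv_deriv_le (y i)⟩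
    · exact .const 0
  have hle (y : ι → ℝ) : (if i = j then deriv (deriv m.ψb) (y i) else 0) + m.M i j
      ≤ (if i = j then K else 0) + |m.M i j| := by
    gcongr ?_ + ?_
    · split_ifs
      · exact (le_abs_self _).trans (m.hasBoundedDerivs.abs_deriv_deriv_le _)
      · exact le_rfl
    · exact le_abs_self _
  rw [m.covariance_energyDeriv hj (m.isTame_energyDeriv i) hsecond
    fun y t ↦ m.hasDerivAt_energyDeriv y i j t]
  refine (m.condMean_mono hsecond (.const _) hle A x).trans_eq ?_
  rw [condMean, integral_const, probReal_univ, one_smul]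

lemma variance_sum_energyDeriv_le (x : ι → ℝ) :
    Var[fun y ↦ ∑ i, m.energyDeriv i y; m.gibbs univ x] ≤ (2 + K) * Fintype.card ι := by
  rw [variance_fun_sum fun i ↦ m.memLp_gibbs (m.isTame_energyDeriv i) _ x]
  calc ∑ i, ∑ j, cov[m.energyDeriv i, m.energyDeriv j; m.gibbs univ x]
      ≤ ∑ i, ∑ j, ((if i = j then K else 0) + |m.M i j|) := by
        gcongr with i _ j
        exact m.covariance_energyDeriv_energyDeriv_le (mem_univ j) i x
    _ = ∑ i, (K + ∑ j, |m.M i j|) := by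
        simp only [sum_add_distrib, sum_ite_eq, mem_univ, if_true]
    _ ≤ ∑ _i : ι, (K + 2) := by
        gcongr with i
        exact m.sum_abs_row_le i
    _ = (2 + K) * Fintype.card ι := by rw [sum_const, card_univ, nsmul_eq_mul]; ring

lemma covariance_sum_sum_energyDeriv (x : ι → ℝ) :
    cov[fun y ↦ ∑ k, y k, fun y ↦ ∑ i, m.energyDeriv i y; m.gibbs univ x] = Fintype.card ι := by
  rw [covariance_fun_sum_fun_sum (fun k ↦ m.memLp_gibbs (.coord k) _ x)
    fun i ↦ m.memLp_gibbs (m.isTame_energyDeriv i) _ x]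
  simp [m.covariance_coord_energyDeriv (mem_univ _)]

theorem card_le_mul_variance_sum (x : ι → ℝ) :
    (Fintype.card ι : ℝ) ≤ (2 + K) * Var[fun y ↦ ∑ k, y k; m.gibbs univ x] := by
  have hcauchy := covariance_sq_le (m.memLp_gibbs (.sum univ fun k _ ↦ .coord k) univ x)
    (m.memLp_gibbs (.sum univ fun i _ ↦ m.isTame_energyDeriv i) univ x)
  rw [m.covariance_sum_sum_energyDeriv] at hcauchy
  rcases (Nat.cast_nonneg (α := ℝ) (Fintype.card ι)).eq_or_lt with hcard | hcard
  · have := m.K_nonneg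
    have := variance_nonneg (fun y : ι → ℝ ↦ ∑ k, y k) (m.gibbs univ x)
    rw [← hcard]
    positivity
  · refine le_of_mul_le_mul_right ?_ hcard
    calc (Fintype.card ι : ℝ) * Fintype.card ι
        ≤ Var[fun y ↦ ∑ k, y k; m.gibbs univ x] * ((2 + K) * Fintype.card ι) := by
          rw [← pow_two]
          exact hcauchy.trans (mul_le_mul_of_nonneg_left (m.variance_sum_energyDeriv_le x)
            (variance_nonneg _ _))
      _ = (2 + K) * Var[fun y ↦ ∑ k, y k; m.gibbs univ x] * Fintype.card ι := by ring

end CramerRao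

section Response

variable {ι : Type*} [Fintype ι] [DecidableEq ι] {K δ : ℝ} (m : Model ι K δ) {A : Finset ι}
  {i : ι} {g : (ι → ℝ) → ℝ}

lemma envelope_update_le {c r u : ℝ} (hc : 0 ≤ c) (hu : |u| ≤ r) (i : ι) (y : ι → ℝ) :
    m.envelope c (update y i u)
      ≤ (c + |m.s i| + K) * r + δ / 2 * y i ^ 2 + m.envelope c y := by
  have hrest : ∑ j ∈ univ.erase i,
      ((c + |m.s j| + K) * |update y i u j| - δ / 2 * update y i u j ^ 2)
      = ∑ j ∈ univ.erase i, ((c + |m.s j| + K) * |y j| - δ / 2 * y j ^ 2) :=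
    sum_congr rfl fun j hj ↦ by rw [update_of_ne (ne_of_mem_erase hj)]
  have hK := m.K_nonneg
  have hδ := m.δ_pos
  have hle : (c + |m.s i| + K) * |u| ≤ (c + |m.s i| + K) * r := by gcongr
  have hy : 0 ≤ (c + |m.s i| + K) * |y i| := by positivity
  have hsq : 0 ≤ δ / 2 * u ^ 2 := by positivity
  rw [envelope, envelope, ← add_sum_erase _ _ (mem_univ i), ← add_sum_erase _ _ (mem_univ i),
    hrest, update_self]
  linarith

lemma exists_abs_mul_weight_update_le (hg : IsTame g) (i : ι) (r : ℝ) (x : ι → ℝ) :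
    ∃ C c, ∀ y u, y i = x i → |u| ≤ r →
      |g (update y i u) * m.weight (update y i u)| ≤ C * Real.exp (m.envelope c y) := by
  obtain ⟨C, hC, c, hc, hbound⟩ := m.exists_abs_mul_weight_le hg
  refine ⟨C * Real.exp ((c + |m.s i| + K) * r + δ / 2 * x i ^ 2), c, fun y u hy hu ↦ ?_⟩
  rw [mul_assoc, ← Real.exp_add, ← hy]
  exact (hbound _).trans (mul_le_mul_of_nonneg_left
    (Real.exp_le_exp.2 (m.envelope_update_le hc hu i y)) hC)

lemma integrable_mul_weight_update (hg : IsTame g) (hi : i ∉ A) (x : ι → ℝ) (t : ℝ) :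
    Integrable (fun y ↦ g (update y i t) * m.weight (update y i t)) (partialVolume A x) := by
  have hint := m.integrable_mul_weight hg A (update x i t)
  rw [partialVolume_update hi] at hint
  exact hint.comp_measurable (measurable_update_const i t)

lemma hasDerivAt_integral_mul_weight (hi : i ∉ A) (hg : IsTame g)
    (hgi : DependsOn g ({i}ᶜ : Set ι)) (x : ι → ℝ) (t : ℝ) :
    HasDerivAt (fun t ↦ ∫ y, g y * m.weight y ∂partialVolume A (update x i t))
      (-∫ y, g y * m.energyDeriv i y * m.weight y ∂partialVolume A (update x i t)) t := by
  have hgd := hg.mul (m.isTame_energyDeriv i)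
  have hgw : Measurable fun y ↦ g y * m.weight y := hg.measurable.mul m.measurable_weight
  have hgdw : Measurable fun y ↦ g y * m.energyDeriv i y * m.weight y :=
    hgd.measurable.mul m.measurable_weight
  have hgu (y : ι → ℝ) (u : ℝ) : g (update y i u) = g y :=
    hgi fun j hj ↦ update_of_ne (by simpa using hj) _ _
  obtain ⟨C, c, hbound⟩ := m.exists_abs_mul_weight_update_le hgd i (|t| + 1) x
  simp only [integral_partialVolume_update hgw hi x]
  rw [integral_partialVolume_update hgdw hi x, ← integral_neg]
  refine (hasDerivAt_integral_of_dominated_loc_of_deriv_le (s := Metric.ball t 1)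
    (bound := fun y ↦ C * Real.exp (m.envelope c y))
    (F := fun t y ↦ g (update y i t) * m.weight (update y i t))
    (F' := fun t y ↦ -(g (update y i t) * m.energyDeriv i (update y i t) * m.weight (update y i t)))
    (Metric.ball_mem_nhds t one_pos)
    (Filter.Eventually.of_forall fun u ↦
      (hgw.comp (measurable_update_const i u)).aestronglyMeasurable)
    (m.integrable_mul_weight_update hg hi x t)
    (hgdw.comp (measurable_update_const i t)).neg.aestronglyMeasurable ?_
    ((m.integrable_exp_envelope c A x).const_mul C) ?_).2
  · filter_upwards [ae_partialVolume A x] with y hy u hu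
    rw [Metric.mem_ball, Real.dist_eq] at hu
    rw [norm_neg, Real.norm_eq_abs]
    exact hbound y u (hy i hi) (by linarith [abs_sub_abs_le_abs_sub u t])
  · refine Filter.Eventually.of_forall fun y u _ ↦ ?_
    simp only [hgu]
    exact ((m.hasDerivAt_weight y i u).const_mul (g y)).congr_deriv (by ring)

lemma hasDerivAt_partitionFunction (hi : i ∉ A) (x : ι → ℝ) (t : ℝ) :
    HasDerivAt (fun t ↦ m.partitionFunction A (update x i t))
      (-(m.condMean A (m.energyDeriv i) (update x i t)
        * m.partitionFunction A (update x i t))) t := by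
  have hderiv := m.hasDerivAt_integral_mul_weight hi (.const 1) (fun _ _ _ ↦ rfl) x t
  simp only [one_mul] at hderiv
  rwa [m.integral_mul_weight] at hderiv

lemma hasDerivAt_condMean (hi : i ∉ A) (hg : IsTame g) (hgi : DependsOn g ({i}ᶜ : Set ι))
    (x : ι → ℝ) (t : ℝ) :
    HasDerivAt (fun t ↦ m.condMean A g (update x i t))
      (-cov[g, m.energyDeriv i; m.gibbs A (update x i t)]) t := by
  have hnum := m.hasDerivAt_integral_mul_weight hi hg hgi x t
  have hden := m.hasDerivAt_partitionFunction hi x t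
  have hpos := (m.partitionFunction_pos A (update x i t)).ne'
  simp only [m.condMean_eq_div A g]
  refine (hnum.div hden hpos).congr_deriv ?_
  have hcov : cov[g, m.energyDeriv i; m.gibbs A (update x i t)]
      = m.condMean A (fun y ↦ g y * m.energyDeriv i y) (update x i t)
        - m.condMean A g (update x i t) * m.condMean A (m.energyDeriv i) (update x i t) :=
    covariance_eq_sub (m.memLp_gibbs hg _ _) (m.memLp_gibbs (m.isTame_energyDeriv i) _ _)
  rw [hcov, m.integral_mul_weight, m.integral_mul_weight]
  field_simp
  ring

end Response

section MeanForce

variable {ι : Type*} [Fintype ι] [DecidableEq ι] {K δ : ℝ} (m : Model ι K δ) {A : Finset ι}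
  {i k : ι}

lemma condMean_energyDeriv_eq_add (A : Finset ι) (i : ι) (x : ι → ℝ) :
    m.condMean A (m.energyDeriv i) x = m.condMean A (fun y ↦ deriv m.ψb (y i)) x + m.s i
      + ∑ j, m.M i j * m.condMean A (fun y ↦ y j) x := by
  have hψ := m.isTame_deriv_ψb i
  have hcoord (j : ι) : IsTame fun y : ι → ℝ ↦ m.M i j * y j := (IsTame.coord j).const_mul _
  simp only [condMean, energyDeriv]
  rw [integral_add (m.integrable_gibbs (hψ.add (.const _)) A x)
      (m.integrable_gibbs (.sum _ fun j _ ↦ hcoord j) A x),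
    integral_add (m.integrable_gibbs hψ A x) (integrable_const _), integral_const, probReal_univ,
    one_smul, integral_finsetSum _ fun j _ ↦ m.integrable_gibbs (hcoord j) A x]
  simp only [integral_const_mul]

lemma condMean_coord_of_notMem (hk : k ∉ A) (x : ι → ℝ) : m.condMean A (fun y ↦ y k) x = x k :=
  m.condMean_of_dependsOn (fun _ _ h ↦ h k (by simpa using hk)) x

lemma abs_condMean_energyDeriv_sub_le (A : Finset ι) (k : ι) (x x' : ι → ℝ) :
    |m.condMean A (m.energyDeriv k) x' - m.condMean A (m.energyDeriv k) x
      - ∑ j, m.M k j * (m.condMean A (fun y ↦ y j) x' - m.condMean A (fun y ↦ y j) x)|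
      ≤ 2 * K := by
  have hψ := m.abs_condMean_le (fun y : ι → ℝ ↦ m.hasBoundedDerivs.abs_deriv_le (y k)) A
  have hdiff : m.condMean A (m.energyDeriv k) x' - m.condMean A (m.energyDeriv k) x
      - ∑ j, m.M k j * (m.condMean A (fun y ↦ y j) x' - m.condMean A (fun y ↦ y j) x)
      = m.condMean A (fun y ↦ deriv m.ψb (y k)) x'
        - m.condMean A (fun y ↦ deriv m.ψb (y k)) x := by
    simp only [m.condMean_energyDeriv_eq_add, mul_sub, sum_sub_distrib]
    ring
  rw [hdiff]
  linarith [abs_sub (m.condMean A (fun y ↦ deriv m.ψb (y k)) x')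
    (m.condMean A (fun y ↦ deriv m.ψb (y k)) x), hψ x, hψ x']

lemma abs_condMean_coord_update_sub_le (hi : i ∉ A) (x : ι → ℝ) (t t' : ℝ) (j : ι) :
    |m.condMean A (fun y ↦ y j) (update x i t') - m.condMean A (fun y ↦ y j) (update x i t)|
      ≤ |t' - t| + 2 * K / δ := by
  have hK := m.K_nonneg
  refine m.isDominant.abs_le_of_abs_sum_mul_le m.δ_pos (abs_nonneg _) (by positivity)
    (d := fun j ↦ m.condMean A (fun y ↦ y j) (update x i t')
      - m.condMean A (fun y ↦ y j) (update x i t)) (fun k ↦ ?_) j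
  by_cases hk : k ∈ A
  · right
    simpa only [m.condMean_energyDeriv hk, sub_self, zero_sub, abs_neg]
      using m.abs_condMean_energyDeriv_sub_le A k (update x i t) (update x i t')
  · left
    rw [m.condMean_coord_of_notMem hk, m.condMean_coord_of_notMem hk]
    rcases eq_or_ne k i with rfl | hki
    · simp only [update_self, le_refl]
    · simp only [update_of_ne hki, sub_self, abs_zero, abs_nonneg]

lemma le_condMean_energyDeriv_update_sub (hi : i ∉ A) (x : ι → ℝ) {t t' : ℝ} (ht : t ≤ t') :
    δ * (t' - t) - 2 * K / δ ≤ m.condMean A (m.energyDeriv i) (update x i t')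
      - m.condMean A (m.energyDeriv i) (update x i t) := by
  have hK := m.K_nonneg
  have hδ := m.δ_pos
  have hdispl := m.abs_condMean_coord_update_sub_le hi x t t'
  rw [abs_of_nonneg (sub_nonneg.2 ht)] at hdispl
  have hforce := abs_le.1 (m.abs_condMean_energyDeriv_sub_le A i (update x i t) (update x i t'))
  rw [← add_sum_erase _ _ (mem_univ i), m.isDominant.diag, m.condMean_coord_of_notMem hi,
    m.condMean_coord_of_notMem hi, update_self, update_self] at hforce
  have hrest := abs_le.1 (m.isDominant.abs_sum_erase_mul_le i
    (by have := sub_nonneg.2 ht; positivity) fun j _ ↦ hdispl j)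
  have hcancel : (1 - δ) * (2 * K / δ) = 2 * K / δ - 2 * K := by field_simp
  linarith [hforce.1, hrest.1]

end MeanForce

end Model

/-- The factor by which revealing one site may reduce the variance of a function of the other
sites. -/
def revealConst (K δ : ℝ) : ℝ := 1 + 16 * tailRatio δ (2 * K / δ) ^ 2 * spinVarBound K δ

lemma one_le_revealConst (K : ℝ) {δ : ℝ} (hδ : 0 < δ) : 1 ≤ revealConst K δ := by
  have := spinVarBound_nonneg K hδ
  exact le_add_of_nonneg_right (by positivity)

namespace Model

section SingleSite

variable {ι : Type*} [Fintype ι] [DecidableEq ι] {K δ : ℝ} (m : Model ι K δ) {A : Finset ι}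
  {i : ι} {g u : (ι → ℝ) → ℝ}

lemma isNearlyLogConcave_partitionFunction (A : Finset ι) (i : ι) (x : ι → ℝ) :
    IsNearlyLogConcave δ (2 * K / δ) (fun t ↦ m.partitionFunction (A.erase i) (update x i t))
      fun t ↦ m.condMean (A.erase i) (m.energyDeriv i) (update x i t) where
  pos _ := m.partitionFunction_pos _ _
  integrable :=
    (integrable_partialVolume_singleton_iff
      (measurable_integral_partialVolume m.measurable_weight _) i x).1
      (integrable_integral_partialVolume m.measurable_weight (by simp) (m.integrable_weight _ x))
  hasDerivAt t := m.hasDerivAt_partitionFunction (notMem_erase i A) x t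
  increment _ _ ht := m.le_condMean_energyDeriv_update_sub (notMem_erase i A) x ht

lemma integral_mul_partitionFunction_erase (hi : i ∈ A) (hu : IsBoundedMeasurable u)
    (hd : DependsOn u ((A.erase i : Finset ι) : Set ι)ᶜ) (x : ι → ℝ) :
    ∫ t, u (update x i t) * m.partitionFunction (A.erase i) (update x i t)
      = m.condMean A u x * m.partitionFunction A x := by
  have huw : Measurable fun y ↦ u y * m.weight y := hu.measurable.mul m.measurable_weight
  have hunion : {i} ∪ A.erase i = A := insert_erase hi
  have hint := m.integrable_mul_weight hu.isTame A x
  rw [← integral_mul_weight]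
  rw [← hunion] at hint
  conv_rhs => rw [← hunion, integral_partialVolume_union huw (by simp) hint,
    integral_partialVolume_singleton (measurable_integral_partialVolume huw _)]
  simp only [integral_mul_weight, m.condMean_of_dependsOn hd]

lemma covariance_energyDeriv_sq_le (hi : i ∉ A) (hg : IsTame g) (x : ι → ℝ) :
    cov[g, m.energyDeriv i; m.gibbs A x] ^ 2
      ≤ 4 * spinVarBound K δ * Var[g; m.gibbs A x] := by
  have hvar : Var[m.energyDeriv i; m.gibbs A x] ≤ 4 * spinVarBound K δ := by
    have hsq := pow_le_pow_left₀ (Real.sqrt_nonneg _) (m.sqrt_variance_energyDeriv_le hi x) 2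
    rw [Real.sq_sqrt (variance_nonneg _ _), mul_pow,
      Real.sq_sqrt (spinVarBound_nonneg K m.δ_pos)] at hsq
    linarith
  rw [mul_comm]
  exact (covariance_sq_le (m.memLp_gibbs hg A x) (m.memLp_gibbs (m.isTame_energyDeriv i) A x)).trans
    (mul_le_mul_of_nonneg_left hvar (variance_nonneg _ _))

lemma isBoundedMeasurable_covariance_energyDeriv_sq (hi : i ∉ A) (hg : IsBoundedMeasurable g) :
    IsBoundedMeasurable fun x ↦ cov[g, m.energyDeriv i; m.gibbs A x] ^ 2 := by
  have hd := m.isTame_energyDeriv i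
  obtain ⟨C, hC⟩ := (m.isBoundedMeasurable_variance_gibbs hg A).bounded
  refine ⟨?_, 4 * spinVarBound K δ * C, fun x ↦ ?_⟩
  · simp only [fun x ↦ covariance_eq_sub (m.memLp_gibbs hg.isTame A x) (m.memLp_gibbs hd A x)]
    exact ((m.measurable_condMean (hg.measurable.mul hd.measurable) A).sub
      ((m.measurable_condMean hg.measurable A).mul
        (m.measurable_condMean hd.measurable A))).pow_const 2
  · have := spinVarBound_nonneg K m.δ_pos
    rw [abs_of_nonneg (sq_nonneg _)]
    exact (m.covariance_energyDeriv_sq_le hi hg.isTame x).trans (by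
      gcongr
      exact (le_abs_self _).trans (hC x))

lemma exists_condMean_sub_sq_le (hi : i ∈ A) (hg : IsBoundedMeasurable g)
    (hgi : DependsOn g ({i}ᶜ : Set ι)) (x : ι → ℝ) :
    ∃ c, m.condMean A (fun y ↦ (m.condMean (A.erase i) g y - c) ^ 2) x
      ≤ 4 * tailRatio δ (2 * K / δ) ^ 2
        * m.condMean A (fun y ↦ cov[g, m.energyDeriv i; m.gibbs (A.erase i) y] ^ 2) x := by
  have hiA := notMem_erase i A
  have hcov := m.isBoundedMeasurable_covariance_energyDeriv_sq hiA hg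
  have hlaw := m.isNearlyLogConcave_partitionFunction A i x
  have hint : Integrable fun t ↦ (-cov[g, m.energyDeriv i; m.gibbs (A.erase i) (update x i t)]) ^ 2
      * m.partitionFunction (A.erase i) (update x i t) := by
    obtain ⟨C, hC⟩ := hcov.bounded
    simp only [neg_sq]
    exact hlaw.integrable.bdd_mul (c := C) (hcov.measurable.comp
      (measurable_update x)).aestronglyMeasurable (Filter.Eventually.of_forall fun t ↦ hC _)
  obtain ⟨c, hc⟩ := hlaw.poincare m.δ_pos (m.hasDerivAt_condMean hiA hg.isTame hgi x) hint
  refine ⟨c, le_of_mul_le_mul_right ?_ (m.partitionFunction_pos A x)⟩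
  have hmean := (m.isBoundedMeasurable_condMean hg (A.erase i)).sub (.const c)
  simp only [neg_sq] at hc
  rwa [m.integral_mul_partitionFunction_erase hi hmean.sq fun y y' h ↦ by
      simp only [m.dependsOn_condMean _ g h],
    m.integral_mul_partitionFunction_erase hi hcov fun y y' h ↦ by
      simp only [m.dependsOn_gibbs _ h], ← mul_assoc] at hc

end SingleSite

section Reveal

variable {ι : Type*} [Fintype ι] [DecidableEq ι] {K δ : ℝ} (m : Model ι K δ) {A B : Finset ι}
  {i : ι} {g u : (ι → ℝ) → ℝ}

lemma variance_condMean_erase_le (hi : i ∈ A) (hg : IsBoundedMeasurable g)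
    (hgi : DependsOn g ({i}ᶜ : Set ι)) (x : ι → ℝ) :
    Var[m.condMean (A.erase i) g; m.gibbs A x]
      ≤ 16 * tailRatio δ (2 * K / δ) ^ 2 * spinVarBound K δ
        * m.condMean A (fun y ↦ Var[g; m.gibbs (A.erase i) y]) x := by
  have hiA := notMem_erase i A
  obtain ⟨c, hc⟩ := m.exists_condMean_sub_sq_le hi hg hgi x
  have hcov : m.condMean A (fun y ↦ cov[g, m.energyDeriv i; m.gibbs (A.erase i) y] ^ 2) x
      ≤ 4 * spinVarBound K δ * m.condMean A (fun y ↦ Var[g; m.gibbs (A.erase i) y]) x := by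
    rw [condMean, condMean, ← integral_const_mul]
    exact m.condMean_mono (m.isBoundedMeasurable_covariance_energyDeriv_sq hiA hg).isTame
      ((m.isBoundedMeasurable_variance_gibbs hg _).isTame.const_mul _)
      (m.covariance_energyDeriv_sq_le hiA hg.isTame) A x
  calc Var[m.condMean (A.erase i) g; m.gibbs A x]
      ≤ m.condMean A (fun y ↦ (m.condMean (A.erase i) g y - c) ^ 2) x :=
        variance_le_integral_sub_sq (m.measurable_condMean hg.measurable _).aestronglyMeasurable c
    _ ≤ _ := hc
    _ ≤ 4 * tailRatio δ (2 * K / δ) ^ 2 * (4 * spinVarBound K δ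
          * m.condMean A (fun y ↦ Var[g; m.gibbs (A.erase i) y]) x) := by gcongr
    _ = _ := by ring

lemma variance_le_revealConst_mul (hi : i ∈ A) (hg : IsBoundedMeasurable g)
    (hgi : DependsOn g ({i}ᶜ : Set ι)) (x : ι → ℝ) :
    Var[g; m.gibbs A x]
      ≤ revealConst K δ * m.condMean A (fun y ↦ Var[g; m.gibbs (A.erase i) y]) x := by
  rw [m.variance_gibbs_eq_add (erase_subset i A) hg, revealConst, add_mul, one_mul]
  exact add_le_add_right (m.variance_condMean_erase_le hi hg hgi x) _

theorem variance_le_revealConst_pow_mul (hg : IsBoundedMeasurable g) (hu : IsBoundedMeasurable u)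
    (hBA : B ⊆ A) (hgB : DependsOn g (Bᶜ : Set ι)) (huB : DependsOn u (B ∪ Aᶜ : Set ι))
    (x : ι → ℝ) :
    Var[g; m.gibbs A x]
      ≤ revealConst K δ ^ #B * m.condMean A (fun y ↦ (g y - u y) ^ 2) x := by
  induction B using Finset.induction_on generalizing A x with
  | empty =>
    have huA := m.ae_eq_of_dependsOn (A := A) (u := u) (by simpa using huB) x
    have hconst : m.condMean A (fun y ↦ (g y - u y) ^ 2) x = ∫ y, (g y - u x) ^ 2 ∂m.gibbs A x :=
      integral_congr_ae (huA.mono fun y hy ↦ by simp only [hy])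
    rw [hconst, card_empty, pow_zero, one_mul]
    exact variance_le_integral_sub_sq hg.measurable.aestronglyMeasurable (u x)
  | insert b B hb ih =>
    have hBA' : B ⊆ A.erase b :=
      subset_erase.2 ⟨(subset_insert b B).trans hBA, hb⟩
    have huB' : DependsOn u (B ∪ (A.erase b : Finset ι)ᶜ : Set ι) := huB.mono fun j hj ↦ by
      by_cases hjb : j = b
      · simp [hjb]
      · simpa [hjb] using hj
    have hone := m.variance_le_revealConst_mul (hBA (mem_insert_self b B)) hg
      (hgB.mono (by simp)) x
    have hrest := ih hBA' (hgB.mono (by simp)) huB'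
    have hpos := zero_le_one.trans (one_le_revealConst K m.δ_pos)
    refine hone.trans ?_
    rw [card_insert_of_notMem hb, pow_succ', mul_assoc]
    refine mul_le_mul_of_nonneg_left ?_ hpos
    rw [← m.condMean_condMean (erase_subset b A) (hg.sub hu).sq, condMean, condMean,
      ← integral_const_mul]
    exact m.condMean_mono (m.isBoundedMeasurable_variance_gibbs hg _).isTame
      ((m.isBoundedMeasurable_condMean (hg.sub hu).sq _).isTame.const_mul _) hrest A x

end Reveal

end Model

/-- The factor by which conditioning on the complement of a set with `r` boundary sites contracts
the standard deviation of a function of the set. -/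
def contraction (K δ : ℝ) (r : ℕ) : ℝ := √(1 - (revealConst K δ ^ r)⁻¹)

lemma contraction_nonneg (K δ : ℝ) (r : ℕ) : 0 ≤ contraction K δ r := Real.sqrt_nonneg _

lemma contraction_lt_one (K : ℝ) {δ : ℝ} (hδ : 0 < δ) (r : ℕ) : contraction K δ r < 1 := by
  have hinv : 0 < (revealConst K δ ^ r)⁻¹ :=
    inv_pos.2 (pow_pos (zero_lt_one.trans_le (one_le_revealConst K hδ)) r)
  rw [contraction, Real.sqrt_lt' one_pos]
  linarith

namespace Model

section Markov

variable {ι : Type*} [Fintype ι] [DecidableEq ι] {K δ : ℝ} (m : Model ι K δ) {A B : Finset ι}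
  {g : (ι → ℝ) → ℝ} {r : ℕ}

open Classical in
/-- The sites outside `A` that interact with `A`. -/
def boundary (A : Finset ι) : Finset ι := univ.filter fun j ↦ j ∉ A ∧ ∃ i ∈ A, m.M i j ≠ 0

lemma mem_boundary {j : ι} : j ∈ m.boundary A ↔ j ∉ A ∧ ∃ i ∈ A, m.M i j ≠ 0 := by
  simp [boundary]

lemma energy_piecewise_sub_eq {x x' : ι → ℝ} (h : ∀ j ∈ m.boundary A, x j = x' j)
    (z z' : ι → ℝ) :
    m.energy (A.piecewise z x) - m.energy (A.piecewise z x')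
      = m.energy (A.piecewise z' x) - m.energy (A.piecewise z' x') := by
  have hcross {i j : ι} (hi : i ∈ A) (hj : j ∉ A) : m.M i j * x j = m.M i j * x' j := by
    by_cases hij : m.M i j = 0
    · rw [hij, zero_mul, zero_mul]
    · rw [h j (m.mem_boundary.2 ⟨hj, i, hi, hij⟩)]
  simp only [energy, add_sub_add_comm, ← mul_sub, ← sum_sub_distrib]
  congr 1
  · refine sum_congr rfl fun i _ ↦ ?_
    by_cases hi : i ∈ A <;> simp only [hi, not_false_eq_true, piecewise_eq_of_mem,
      piecewise_eq_of_notMem, sub_self]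
  · refine congrArg _ (sum_congr rfl fun i _ ↦ sum_congr rfl fun j _ ↦ ?_)
    by_cases hi : i ∈ A <;> by_cases hj : j ∈ A <;>
      simp only [hi, hj, not_false_eq_true, piecewise_eq_of_mem, piecewise_eq_of_notMem]
    · ring
    · linear_combination (z i - z' i) * hcross hi hj
    · rw [m.isDominant.symm i j]
      linear_combination (z j - z' j) * hcross hj hi

lemma exists_weight_piecewise_eq_mul {x x' : ι → ℝ} (h : ∀ j ∈ m.boundary A, x j = x' j) :
    ∃ c > 0, ∀ z, m.weight (A.piecewise z x) = c * m.weight (A.piecewise z x') := by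
  refine ⟨Real.exp (m.energy (A.piecewise 0 x') - m.energy (A.piecewise 0 x)), Real.exp_pos _,
    fun z ↦ ?_⟩
  rw [weight, weight, ← Real.exp_add, Real.exp_eq_exp]
  linarith [m.energy_piecewise_sub_eq h z 0]

lemma dependsOn_condMean_boundary (hg : Measurable g) (hgA : DependsOn g (A : Set ι)) :
    DependsOn (m.condMean A g) (m.boundary A : Set ι) := fun x x' h ↦ by
  obtain ⟨c, hc, hweight⟩ := m.exists_weight_piecewise_eq_mul h
  have hgz (z : ι → ℝ) : g (A.piecewise z x) = g (A.piecewise z x') :=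
    hgA fun i hi ↦ by simp [mem_coe.1 hi]
  have hgw : Measurable fun y ↦ g y * m.weight y := hg.mul m.measurable_weight
  have hnum : ∫ y, g y * m.weight y ∂partialVolume A x
      = c * ∫ y, g y * m.weight y ∂partialVolume A x' := by
    rw [integral_partialVolume hgw A x 0, integral_partialVolume hgw A x' 0, ← integral_const_mul]
    simp only [hweight, hgz, mul_left_comm c]
  have hden : m.partitionFunction A x = c * m.partitionFunction A x' := by
    rw [partitionFunction, partitionFunction, integral_partialVolume m.measurable_weight A x 0,
      integral_partialVolume m.measurable_weight A x' 0, ← integral_const_mul]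
    simp only [hweight]
  rw [condMean_eq_div, condMean_eq_div, hnum, hden, mul_div_mul_left _ _ hc.ne']

lemma condMean_sub_condMean_sq (hBA : B ⊆ A) (hg : IsBoundedMeasurable g) :
    m.condMean A (fun y ↦ (g y - m.condMean B g y) ^ 2)
      = m.condMean A fun y ↦ Var[g; m.gibbs B y] := by
  rw [← m.condMean_condMean hBA (hg.sub (m.isBoundedMeasurable_condMean hg B)).sq]
  congr 1
  ext y
  rw [variance_eq_integral hg.measurable.aemeasurable]
  refine integral_congr_ae ?_
  filter_upwards [m.ae_eq_of_dependsOn (m.dependsOn_condMean B g) y] with z hz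
  rw [hz, condMean]

theorem sqrt_variance_condMean_le (hBA : B ∪ m.boundary B ⊆ A) (hr : #(m.boundary B) ≤ r)
    (hg : IsBoundedMeasurable g) (hgB : DependsOn g (B : Set ι)) (x : ι → ℝ) :
    √Var[m.condMean B g; m.gibbs A x] ≤ contraction K δ r * √Var[g; m.gibbs A x] := by
  obtain ⟨hB, hbdry⟩ := union_subset_iff.1 hBA
  have hone := one_le_revealConst K m.δ_pos
  have hpos : 0 < revealConst K δ ^ r := pow_pos (zero_lt_one.trans_le hone) r
  have hgc : DependsOn g ((m.boundary B : Set ι)ᶜ) :=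
    hgB.mono fun i hi hmem ↦ (m.mem_boundary.1 hmem).1 hi
  have hreveal : Var[g; m.gibbs A x]
      ≤ revealConst K δ ^ r * m.condMean A (fun y ↦ Var[g; m.gibbs B y]) x := by
    have := m.variance_le_revealConst_pow_mul hg (m.isBoundedMeasurable_condMean hg B) hbdry hgc
      ((m.dependsOn_condMean_boundary hg.measurable hgB).mono Set.subset_union_left) x
    rw [m.condMean_sub_condMean_sq hB hg] at this
    refine this.trans (mul_le_mul_of_nonneg_right (pow_le_pow_right₀ hone hr) ?_)
    exact integral_nonneg fun y ↦ variance_nonneg _ _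
  rw [contraction, ← Real.sqrt_mul (sub_nonneg.2 (inv_le_one_of_one_le₀ (one_le_pow₀ hone)))]
  refine Real.sqrt_le_sqrt ?_
  rw [← inv_mul_le_iff₀ hpos] at hreveal
  linarith [m.variance_gibbs_eq_add hB hg x]

end Markov

end Model

section Constants

/-- Bounds the standard deviation of the conditional expectation of the total spin of the sites
`k, k + 1, …` given the others: the fixed point of `t ↦ contraction K δ r * (a + t)`, where
`a` bounds the standard deviation of the total spin of `r` sites. -/
def responseConst (K δ : ℝ) (r : ℕ) : ℝ :=
  contraction K δ r * (r * √(spinVarBound K δ)) / (1 - contraction K δ r)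

variable {K δ : ℝ} {r : ℕ}

lemma responseConst_nonneg (K : ℝ) (hδ : 0 < δ) (r : ℕ) : 0 ≤ responseConst K δ r :=
  div_nonneg (mul_nonneg (contraction_nonneg K δ r) (by positivity))
    (sub_nonneg.2 (contraction_lt_one K hδ r).le)

lemma contraction_mul_add_responseConst (K : ℝ) (hδ : 0 < δ) (r : ℕ) :
    contraction K δ r * (r * √(spinVarBound K δ) + responseConst K δ r) = responseConst K δ r := by
  have := (sub_pos.2 (contraction_lt_one K hδ r)).ne'
  rw [responseConst]
  field_simp
  ring

/-- Bounds the increase of the variance of the total spin per block of `r` sites. -/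
def blockConst (K δ : ℝ) (r : ℕ) : ℝ :=
  (r * √(spinVarBound K δ)) ^ 2 + 2 * (r * √(spinVarBound K δ) * responseConst K δ r)

end Constants

section SpinSum

variable {ι : Type*} {φ : ℝ → ℝ}

/-- The total of the spins in `A`, each transformed by `φ`. -/
def spinSum (φ : ℝ → ℝ) (A : Finset ι) (y : ι → ℝ) : ℝ := ∑ i ∈ A, φ (y i)

lemma dependsOn_spinSum (φ : ℝ → ℝ) (A : Finset ι) : DependsOn (spinSum φ A) (A : Set ι) :=
  fun _ _ h ↦ sum_congr rfl fun i hi ↦ by rw [h i hi]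

lemma measurable_spinSum (hφ : Measurable φ) (A : Finset ι) : Measurable (spinSum φ A) :=
  measurable_fun_sum A fun i _ ↦ hφ.comp (measurable_pi_apply i)

lemma IsBoundedMeasurable.comp_eval (hφ : IsBoundedMeasurable φ) (i : ι) :
    IsBoundedMeasurable fun y : ι → ℝ ↦ φ (y i) := by
  obtain ⟨C, hC⟩ := hφ.bounded
  exact ⟨hφ.measurable.comp (measurable_pi_apply i), C, fun y ↦ hC (y i)⟩

lemma IsBoundedMeasurable.spinSum (hφ : IsBoundedMeasurable φ) (A : Finset ι) :
    IsBoundedMeasurable (spinSum φ A) :=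
  .sum A fun i _ ↦ hφ.comp_eval i

lemma Model.sqrt_variance_spinSum_le [Fintype ι] [DecidableEq ι] {K δ : ℝ} (m : Model ι K δ)
    (hφ : LipschitzWith 1 φ) (hφb : IsBoundedMeasurable φ) (A B : Finset ι) (x : ι → ℝ) :
    √Var[SpinSystem.spinSum φ B; m.gibbs A x] ≤ #B * √(spinVarBound K δ) := by
  have hsite (i : ι) : √Var[fun y ↦ φ (y i); m.gibbs A x] ≤ √(spinVarBound K δ) := by
    have := variance_comp_le_of_lipschitzWith hφ (m.memLp_gibbs (.coord i) A x)
    rw [NNReal.coe_one, one_pow, one_mul] at this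
    exact Real.sqrt_le_sqrt (this.trans (m.variance_coord_le A i x))
  refine (sqrt_variance_sum_le B fun i _ ↦
    m.memLp_gibbs (hφb.comp_eval i).isTame A x).trans ?_
  rw [← nsmul_eq_mul]
  exact sum_le_card_nsmul _ _ _ fun i _ ↦ hsite i

end SpinSum

section Upper

variable {N k l : ℕ}

/-- The sites `i` with `k ≤ i`. -/
def upper (N k : ℕ) : Finset (Fin N) := univ.filter fun i ↦ k ≤ (i : ℕ)

@[simp] lemma mem_upper {i : Fin N} : i ∈ upper N k ↔ k ≤ (i : ℕ) := by simp [upper]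

lemma upper_anti (h : k ≤ l) : upper N l ⊆ upper N k := fun i hi ↦ by
  rw [mem_upper] at hi ⊢
  exact h.trans hi

lemma upper_zero (N : ℕ) : upper N 0 = univ := by
  ext i
  simp

lemma upper_eq_empty (h : N ≤ k) : upper N k = ∅ := by
  ext i
  simp [i.isLt.trans_le h]

/-- The block of sites `k ≤ i < k + r`. -/
def block (N k r : ℕ) : Finset (Fin N) := upper N k \ upper N (k + r)

@[simp] lemma mem_block {r : ℕ} {i : Fin N} :
    i ∈ block N k r ↔ k ≤ (i : ℕ) ∧ (i : ℕ) < k + r := by simp [block]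

lemma block_subset_upper (N k r : ℕ) : block N k r ⊆ upper N k := sdiff_subset

lemma card_block_le (N k r : ℕ) : #(block N k r) ≤ r := by
  have hval : Set.MapsTo Fin.val (block N k r : Set (Fin N)) (Ico k (k + r)) := fun i hi ↦ by
    simpa using hi
  simpa using card_le_card_of_injOn _ hval Fin.val_injective.injOn

lemma spinSum_upper (φ : ℝ → ℝ) (N k r : ℕ) :
    spinSum φ (upper N k)
      = fun y ↦ spinSum φ (block N k r) y + spinSum φ (upper N (k + r)) y := by
  ext y
  exact (sum_sdiff (upper_anti (Nat.le_add_right k r))).symm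

end Upper

namespace Model

section Chain

variable {N : ℕ} {K δ : ℝ} {m : Model (Fin N) K δ} {φ : ℝ → ℝ} {r : ℕ}

/-- Only sites at distance less than `r` interact. -/
def HasRange (m : Model (Fin N) K δ) (r : ℕ) : Prop :=
  ∀ i j : Fin N, (i : ℕ) + r ≤ j → m.M i j = 0

lemma HasRange.boundary_upper_subset (hr : m.HasRange r) (k : ℕ) :
    m.boundary (upper N k) ⊆ block N (k - r) r := fun j hj ↦ by
  obtain ⟨hjk, i, hi, hij⟩ := m.mem_boundary.1 hj
  rw [mem_upper] at hjk hi
  have : k < (j : ℕ) + r := by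
    by_contra! hle
    exact hij ((m.isDominant.symm i j).trans (hr j i (hle.trans hi)))
  rw [mem_block]
  omega

variable (m) in
/-- The conditional expectation of the total spin of the sites `k, k + 1, …` given the others. -/
def response (φ : ℝ → ℝ) (k : ℕ) : (Fin N → ℝ) → ℝ :=
  m.condMean (upper N k) (spinSum φ (upper N k))

lemma isBoundedMeasurable_response (hφ : IsBoundedMeasurable φ) (k : ℕ) :
    IsBoundedMeasurable (m.response φ k) :=
  m.isBoundedMeasurable_condMean (hφ.spinSum _) _

lemma HasRange.dependsOn_response (hr : m.HasRange r) (hφ : Measurable φ) (k : ℕ) :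
    DependsOn (m.response φ (k + r)) (block N k r : Set (Fin N)) := by
  have hsub := hr.boundary_upper_subset (k + r)
  rw [Nat.add_sub_cancel] at hsub
  exact (m.dependsOn_condMean_boundary (measurable_spinSum hφ _) (dependsOn_spinSum φ _)).mono
    (coe_subset.2 hsub)

lemma response_eq_condMean_add (hφ : IsBoundedMeasurable φ) (k r : ℕ) :
    m.response φ k = m.condMean (upper N k)
      fun y ↦ spinSum φ (block N k r) y + m.response φ (k + r) y := by
  ext y
  have hblock := (hφ.spinSum (block N k r)).isTame
  rw [m.condMean_add hblock (isBoundedMeasurable_response hφ _).isTame, response, response,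
    m.condMean_condMean (upper_anti (Nat.le_add_right k r)) (hφ.spinSum _), spinSum_upper φ N k r,
    m.condMean_add hblock (hφ.spinSum _).isTame]

lemma sqrt_variance_spinSum_block_le (hφ : LipschitzWith 1 φ) (hφb : IsBoundedMeasurable φ)
    (A : Finset (Fin N)) (k r : ℕ) (x : Fin N → ℝ) :
    √Var[spinSum φ (block N k r); m.gibbs A x] ≤ r * √(spinVarBound K δ) :=
  (m.sqrt_variance_spinSum_le hφ hφb A _ x).trans (by gcongr; exact card_block_le N k r)

lemma HasRange.sqrt_variance_response_le_contraction_mul (hr : m.HasRange r)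
    (hφ : LipschitzWith 1 φ) (hφb : IsBoundedMeasurable φ) (k : ℕ) (x : Fin N → ℝ) :
    √Var[m.response φ k; m.gibbs univ x] ≤ contraction K δ r
      * (r * √(spinVarBound K δ) + √Var[m.response φ (k + r); m.gibbs univ x]) := by
  have hblock := hφb.spinSum (block N k r)
  have hresp := isBoundedMeasurable_response (m := m) hφb (k + r)
  have hdep : DependsOn (fun y ↦ spinSum φ (block N k r) y + m.response φ (k + r) y)
      (upper N k : Set (Fin N)) := fun y y' h ↦ by
    have h' : ∀ i ∈ (block N k r : Set (Fin N)), y i = y' i :=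
      fun i hi ↦ h i (block_subset_upper N k r hi)
    simp only [dependsOn_spinSum φ _ h', hr.dependsOn_response hφb.measurable k h']
  have hcard : #(m.boundary (upper N k)) ≤ r :=
    (card_le_card (hr.boundary_upper_subset k)).trans (card_block_le N _ r)
  rw [response_eq_condMean_add hφb k r]
  refine (m.sqrt_variance_condMean_le (subset_univ _) hcard (hblock.add hresp) hdep x).trans ?_
  refine mul_le_mul_of_nonneg_left ?_ (contraction_nonneg K δ r)
  exact (sqrt_variance_add_le (m.memLp_gibbs hblock.isTame _ x)
    (m.memLp_gibbs hresp.isTame _ x)).trans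
    (add_le_add_left (sqrt_variance_spinSum_block_le hφ hφb _ k r x) _)

lemma variance_spinSum_upper_of_le (φ : ℝ → ℝ) {k : ℕ} (hk : N ≤ k) (x : Fin N → ℝ) :
    Var[spinSum φ (upper N k); m.gibbs univ x] = 0 := by
  rw [upper_eq_empty hk]
  exact variance_eq_zero_of_ae_eq_const (c := 0) (.of_forall fun _ ↦ by simp [spinSum])

lemma HasRange.sqrt_variance_response_le (hr : m.HasRange r) (hφ : LipschitzWith 1 φ)
    (hφb : IsBoundedMeasurable φ) (x : Fin N → ℝ) {n k : ℕ} (hk : N ≤ k + n * r) :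
    √Var[m.response φ k; m.gibbs univ x] ≤ responseConst K δ r := by
  induction n generalizing k with
  | zero =>
    have hzero : Var[m.response φ k; m.gibbs univ x] = 0 :=
      variance_eq_zero_of_ae_eq_const (c := 0) (.of_forall fun y ↦ by
        simp [response, condMean, upper_eq_empty (by simpa using hk : N ≤ k), spinSum])
    rw [hzero, Real.sqrt_zero]
    exact responseConst_nonneg K m.δ_pos r
  | succ n ih =>
    refine (hr.sqrt_variance_response_le_contraction_mul hφ hφb k x).trans ?_
    rw [← contraction_mul_add_responseConst K m.δ_pos]
    have := ih (k := k + r) (by linarith)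
    gcongr
    exact contraction_nonneg K δ r

lemma variance_spinSum_upper_le_add (hφ : LipschitzWith 1 φ) (hφb : IsBoundedMeasurable φ) (k : ℕ)
    (x : Fin N → ℝ)
    (hresp : √Var[m.response φ (k + r); m.gibbs univ x] ≤ responseConst K δ r) :
    Var[spinSum φ (upper N k); m.gibbs univ x]
      ≤ blockConst K δ r + Var[spinSum φ (upper N (k + r)); m.gibbs univ x] := by
  have hS := hφb.spinSum (upper N (k + r))
  have hF := hφb.spinSum (block N k r)
  have hsd := sqrt_variance_spinSum_block_le (m := m) hφ hφb univ k r x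
  have hFdep : DependsOn (spinSum φ (block N k r)) ((upper N (k + r) : Set (Fin N))ᶜ) :=
    (dependsOn_spinSum φ _).mono fun i hi ↦ (mem_sdiff.1 hi).2
  have hvar : Var[spinSum φ (block N k r); m.gibbs univ x] ≤ (r * √(spinVarBound K δ)) ^ 2 :=
    (Real.sqrt_le_left (by positivity)).1 hsd
  have hcov : cov[spinSum φ (block N k r), spinSum φ (upper N (k + r)); m.gibbs univ x]
      ≤ r * √(spinVarBound K δ) * responseConst K δ r := by
    rw [← m.covariance_condMean (subset_univ _) hFdep hF hS]
    refine (le_abs_self _).trans ((abs_covariance_le (m.memLp_gibbs hF.isTame _ x)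
      (m.memLp_gibbs (isBoundedMeasurable_response hφb _).isTame _ x)).trans ?_)
    exact mul_le_mul hsd hresp (Real.sqrt_nonneg _) (by positivity)
  rw [spinSum_upper φ N k r, variance_fun_add (m.memLp_gibbs hF.isTame _ x)
    (m.memLp_gibbs hS.isTame _ x), blockConst]
  linarith

theorem HasRange.variance_spinSum_upper_le (hr : m.HasRange r) (hφ : LipschitzWith 1 φ)
    (hφb : IsBoundedMeasurable φ) (x : Fin N → ℝ) {n k : ℕ} (hk : N ≤ k + n * r) :
    Var[spinSum φ (upper N k); m.gibbs univ x] ≤ n * blockConst K δ r := by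
  induction n generalizing k with
  | zero => simp [variance_spinSum_upper_of_le φ (by simpa using hk : N ≤ k)]
  | succ n ih =>
    have hk' : N ≤ k + r + n * r := by linarith
    have := variance_spinSum_upper_le_add hφ hφb k x
      (hr.sqrt_variance_response_le hφ hφb x hk')
    push_cast
    linarith [ih hk']

end Chain

end Model

section Clip

/-- Truncation of the real line at level `n`. -/
def clip (n : ℕ) (t : ℝ) : ℝ := max (-n) (min n t)

lemma lipschitzWith_clip (n : ℕ) : LipschitzWith 1 (clip n) :=
  (LipschitzWith.id.const_min _).const_max _

lemma isBoundedMeasurable_clip (n : ℕ) : IsBoundedMeasurable (clip n) :=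
  ⟨(lipschitzWith_clip n).continuous.measurable, n, fun _ ↦ abs_le.2
    ⟨le_max_left _ _, max_le (neg_le_self n.cast_nonneg) (min_le_left _ _)⟩⟩

lemma abs_clip_le (n : ℕ) (t : ℝ) : |clip n t| ≤ |t| := by
  have hzero : clip n 0 = 0 := by simp [clip]
  simpa [hzero, Real.dist_eq] using (lipschitzWith_clip n).dist_le_mul t 0

lemma tendsto_clip (t : ℝ) : Filter.Tendsto (fun n ↦ clip n t) Filter.atTop (nhds t) := by
  refine tendsto_const_nhds.congr' ?_
  filter_upwards [Filter.eventually_ge_atTop ⌈|t|⌉₊] with n hn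
  obtain ⟨hneg, hpos⟩ := abs_le.1 (Nat.ceil_le.1 hn)
  rw [clip, min_eq_right hpos, max_eq_right hneg]

variable {N : ℕ} {K δ : ℝ} {m : Model (Fin N) K δ} {r : ℕ}

theorem Model.HasRange.variance_sum_le (hr : m.HasRange r) (hr_pos : 0 < r) (x : Fin N → ℝ) :
    Var[fun y ↦ ∑ i, y i; m.gibbs univ x] ≤ N * blockConst K δ r := by
  have hclip (n : ℕ) : Var[spinSum (clip n) univ; m.gibbs univ x] ≤ N * blockConst K δ r := by
    have := hr.variance_spinSum_upper_le (lipschitzWith_clip n) (isBoundedMeasurable_clip n) x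
      (n := N) (k := 0) (by rw [zero_add]; exact Nat.le_mul_of_pos_right N hr_pos)
    rwa [upper_zero] at this
  have hbound : MemLp (fun y : Fin N → ℝ ↦ ∑ i, |y i|) 2 (m.gibbs univ x) :=
    memLp_finsetSum _ fun i _ ↦ (m.memLp_gibbs (.coord i) univ x).abs
  refine le_of_tendsto (tendsto_variance_of_dominated (F := fun n ↦ spinSum (clip n) univ)
    (fun n ↦ ((isBoundedMeasurable_clip n).spinSum univ).measurable.aestronglyMeasurable)
    hbound (fun n ↦ .of_forall fun y ↦ ?_) (.of_forall fun y ↦ ?_)) (.of_forall hclip)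
  · exact (abs_sum_le_sum_abs _ _).trans (sum_le_sum fun i _ ↦ abs_clip_le n (y i))
  · exact tendsto_finsetSum _ fun i _ ↦ tendsto_clip (y i)

end Clip

section Ensemble

variable {K δ : ℝ} {ψb : ℝ → ℝ}

lemma IsBoundedPerturbation.exists_hasBoundedDerivs (h : IsBoundedPerturbation ψb) :
    ∃ K, HasBoundedDerivs K ψb := by
  obtain ⟨K₁, h₁⟩ := h.bounded_deriv
  obtain ⟨K₂, h₂⟩ := h.bounded_deriv_deriv
  exact ⟨max K₁ K₂, h.differentiable, h.differentiable_deriv,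
    fun z ↦ (h₁ z).trans (le_max_left _ _), fun z ↦ (h₂ z).trans (le_max_right _ _)⟩

variable {N R : ℕ} {M : Matrix (Fin N) (Fin N) ℝ}

lemma sum_eq_add_sum_neighbors (i : Fin N) {f : Fin N → ℝ}
    (hf : ∀ j : Fin N, (R : ℤ) < |((i : ℕ) : ℤ) - ((j : ℕ) : ℤ)| → f j = 0) :
    ∑ j, f j = f i + ∑ j ∈ neighbors R i, f j := by
  have hi : i ∉ neighbors R i := by simp [neighbors]
  rw [← sum_insert hi]
  refine (sum_subset (subset_univ _) fun j _ hj ↦ hf j ?_).symm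
  simp only [neighbors, mem_insert, mem_filter, mem_univ, true_and, Fin.ext_iff, not_or,
    not_and, not_le] at hj
  rw [abs_sub_comm]
  exact hj.2 (Int.one_le_abs (by omega))

namespace IsInteraction

lemma isDominant (hM : IsInteraction R δ M) : IsDominant δ M where
  diag := hM.diag
  symm := hM.symm
  row i := by
    have := hM.dominant i
    rw [sum_eq_add_sum_neighbors (R := R) i fun j hj ↦ by rw [hM.range i j hj, abs_zero]]
    rw [hM.diag] at this ⊢
    rw [abs_one]
    linarith

/-- The grand canonical ensemble as a spin system: the chemical potential `σ` is absorbed into the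
external field. -/
def model (hM : IsInteraction R δ M) (hδ : 0 < δ) (hψb : HasBoundedDerivs K ψb) (s : Fin N → ℝ)
    (σ : ℝ) : Model (Fin N) K δ where
  ψb := ψb
  M := M
  s i := s i - σ
  δ_pos := hδ
  hasBoundedDerivs := hψb
  isDominant := hM.isDominant

variable (hM : IsInteraction R δ M) (hδ : 0 < δ) (hψb : HasBoundedDerivs K ψb) (s : Fin N → ℝ)
  (σ : ℝ)

lemma hasRange_model : (hM.model hδ hψb s σ).HasRange (R + 1) := fun i j hij ↦
  hM.range i j (lt_abs.2 (Or.inr (by omega)))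

lemma neg_energy_model (x : Fin N → ℝ) :
    -(hM.model hδ hψb s σ).energy x = σ * ∑ k, x k - hamiltonian ψb R M s x := by
  have hrow (i : Fin N) :
      ∑ j, M i j * (x i * x j) = x i ^ 2 + ∑ j ∈ neighbors R i, M i j * x i * x j := by
    rw [sum_eq_add_sum_neighbors (R := R) i fun j hj ↦ by rw [hM.range i j hj, zero_mul],
      hM.diag, one_mul, sq]
    simp only [mul_assoc]
  simp only [Model.energy, model, hrow, hamiltonian, singleSite, sum_add_distrib, sub_mul,
    sum_sub_distrib, ← mul_sum]
  ring

lemma gibbs_model (x : Fin N → ℝ) : (hM.model hδ hψb s σ).gibbs univ x = gce ψb R M s σ := by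
  simp only [Model.gibbs, partialVolume_univ, neg_energy_model, gce]

end IsInteraction

end Ensemble

end SpinSystem

end

open SpinSystem in
theorem mainTheorem7_general (K : ℝ) (R : ℕ) (δ : ℝ) (hδ : 0 < δ) :
    ∃ C : ℝ, 0 < C ∧
      ∀ ψb : ℝ → ℝ, HasBoundedDerivs K ψb →
      ∀ N : ℕ, 1 ≤ N →
      ∀ M : Matrix (Fin N) (Fin N) ℝ, IsInteraction R δ M →
      ∀ (s : Fin N → ℝ) (σ : ℝ),
        IsProbabilityMeasure (gce ψb R M s σ) ∧
        MemLp (fun x : Fin N → ℝ ↦ ∑ k, x k) 2 (gce ψb R M s σ) ∧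
        1 / C ≤ 1 / (N : ℝ) * Var[fun x : Fin N → ℝ ↦ ∑ k, x k; gce ψb R M s σ] ∧
        1 / (N : ℝ) * Var[fun x : Fin N → ℝ ↦ ∑ k, x k; gce ψb R M s σ] ≤ C := by
  obtain ⟨C, hC_pos, hC_lower, hC_upper⟩ :
      ∃ C, 0 < C ∧ 2 + K ≤ C ∧ blockConst K δ (R + 1) ≤ C := by
    refine ⟨max 1 (max (2 + K) (blockConst K δ (R + 1))), by positivity, by simp, by simp⟩
  refine ⟨C, hC_pos, fun ψb hψb N hN M hM s σ ↦ ?_⟩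
  have hN_pos : (0 : ℝ) < N := by exact_mod_cast hN
  have hlower := (hM.model hδ hψb s σ).card_le_mul_variance_sum 0
  have hupper := (hM.hasRange_model hδ hψb s σ).variance_sum_le R.succ_pos 0
  rw [Fintype.card_fin] at hlower
  rw [← hM.gibbs_model hδ hψb s σ 0]
  refine ⟨inferInstance, Model.memLp_gibbs _ (.sum _ fun k _ ↦ .coord k) _ _, ?_, ?_⟩
  · rw [one_div_mul_eq_div, div_le_div_iff₀ hC_pos hN_pos, one_mul, mul_comm]
    exact hlower.trans (mul_le_mul_of_nonneg_right hC_lower (variance_nonneg _ _))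
  · rw [one_div_mul_eq_div, div_le_iff₀' hN_pos]
    exact hupper.trans (mul_le_mul_of_nonneg_left hC_upper hN_pos.le)

theorem mainTheorem7 (ψb : ℝ → ℝ) (hψb : SpinSystem.IsBoundedPerturbation ψb)
    (R : ℕ) (δ : ℝ) (hδ : 0 < δ) :
    ∃ C : ℝ, 0 < C ∧
      ∀ (N : ℕ), 1 ≤ N →
      ∀ (M : Matrix (Fin N) (Fin N) ℝ), SpinSystem.IsInteraction R δ M →
      ∀ (s : Fin N → ℝ) (σ : ℝ),
        IsProbabilityMeasure (SpinSystem.gce ψb R M s σ) ∧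
        MemLp (fun x : Fin N → ℝ => ∑ k, x k) 2 (SpinSystem.gce ψb R M s σ) ∧
        1 / C ≤ 1 / (N : ℝ) * variance (fun x : Fin N → ℝ => ∑ k, x k)
          (SpinSystem.gce ψb R M s σ) ∧
        1 / (N : ℝ) * variance (fun x : Fin N → ℝ => ∑ k, x k)
          (SpinSystem.gce ψb R M s σ) ≤ C := by
  obtain ⟨K, hK⟩ := hψb.exists_hasBoundedDerivs
  exact (mainTheorem7_general K R δ hδ).imp fun C hC ↦ ⟨hC.1, hC.2 ψb hK⟩
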